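/- Consider the plant $$\dot x=Ax+Bu+Ep(C_qx)+E_ww,\qquad y=Cx+Du+F_ww,$$ with $x\in\mathbb R^{n_x}$, $u\in\mathbb R^{n_u}$, $y\in\mathbb R^{n_y}$, $w\in\mathbb R^{n_w}$, constant matrices of compatible sizes, $D=0$, and $p:\mathbb R^{n_q}\to\mathbb R^{n_p}$ globally Lipschitz with $p(0)=0$. Given matrices $K_1,K_2,L_1,L_2$, consider the observer $$\dot{\hat x}=A\hat x+Bu+Ep\big(C_q\hat x+L_1(\hat y-y)\big)+L_2(\hat y-y),\qquad \hat y=C\hat x+Du,$$ and the feedback law $k(\hat x)=K_1\hat x+K_2p(C_q\hat x)$. Put $e=x-\hat x$, $z=(x,e)\in\mathbb R^{2n_x}$, with the Euclidean norm. Let $\omega_0>0$; the disturbances are the measurable signals $w$ with $\|w\|_\infty:=\sup_{t\ge0}\|w(t)\|\le\omega_0$. Suppose that there are $\alpha_0>0$, $\mu>0$ and a symmetric positive definite matrix $P$ such that $V(z)=z^\top Pz$ satisfies $\dot V\le-\alpha_0V+\mu\|w\|^2$ along the continuous-time closed loop, in which $u=k(\hat x)$ and the observer receives $y$ at all times (i.e.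 $\nabla V(z)\cdot f(z,w)\le-\alpha_0V(z)+\mu\|w\|^2$ for all $z$ and all $w\in\mathbb R^{n_w}$ with $\|w\|\le\omega_0$, where $\dot z=f(z,w)$ is this closed loop). Consider the closed loop with two asynchronous event-triggering mechanisms: in the observer, $y$ is replaced by $y_s(t)=y(t^y_k)$ for $t\in[t^y_k,t^y_{k+1})$ in both correction terms, and the input is $u(t)=k(\hat x_s(t))$ with $\hat x_s(t)=\hat x(t^u_k)$ for $t\in[t^u_k,t^u_{k+1})$, where $t^y_0=t^u_0=0$ and $$t^y_{k+1}=\inf\{t\ge t^y_k+\tau_y:\ \|y(t^y_k)-y(t)\|>\sigma_y\|y(t)\|+\epsilon_y\},$$ $$t^u_{k+1}=\inf\{t\ge t^u_k+\tau_u:\ \|\hat x(t^u_k)-\hat x(t)\|>\sigma_u\|\hat x(t)\|+\epsilon_u\}$$ ($\inf\emptyset=\infty$). Here the next triggering instants are determined causally: from the latest triggering of either mechanism on, each condition is tested along the flow of the closed loop with the samples currently held; at the first of the resulting two instants the mechanism (or both) whose instant it is takes a new sample, and so on. Then $\tau_y,\sigma_y,\epsilon_y,\tau_u,\sigma_u,\epsilon_u>0$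 can be chosen such that this closed loop is input-to-state practically stable with respect to $w$: there are $\beta_1\in\mathcal{KL}$, $\beta_2\in\mathcal K$ and $d\ge0$ such that for every admissible disturbance $w$ a trajectory on $[0,\infty)$ exists from every initial state $z(0)$, and every such trajectory satisfies $$\|z(t)\|\le\beta_1(\|z(0)\|,t)+\beta_2(\|w\|_\infty)+d\qquad\text{for all }t\ge0 .$$ -/

import Mathlib

open MeasureTheory Set Filter Topology
open scoped NNReal ENNReal

namespace ETC

/-! ### Comparison functions -/

/-- Class `𝒦`: continuous, strictly increasing, vanishing at `0`. -/
def ClassK (f : ℝ≥0 → ℝ≥0) : Prop :=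
  Continuous f ∧ StrictMono f ∧ f 0 = 0

/-- Class `𝒦_∞`: class `𝒦` and unbounded. -/
def ClassKInf (f : ℝ≥0 → ℝ≥0) : Prop :=
  ClassK f ∧ Tendsto f atTop atTop

/-- Class `𝒦ℒ`: jointly continuous, `𝒦_∞` in the first argument, decreasing to `0` in the
second one. -/
def ClassKL (f : ℝ≥0 → ℝ≥0 → ℝ≥0) : Prop :=
  Continuous (fun rs : ℝ≥0 × ℝ≥0 => f rs.1 rs.2) ∧
  (∀ s, ClassKInf fun r => f r s) ∧
  ∀ r, Antitone (f r) ∧ Tendsto (f r) atTop (𝓝 0)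

/-! ### Disturbances and input-to-state practical stability -/

/-- Admissible disturbances: measurable signals with `‖w(t)‖ ≤ ω₀` for all `t ≥ 0`. -/
def Admissible {W : Type*} [NormedAddCommGroup W] [MeasurableSpace W] (ω₀ : ℝ) (w : ℝ → W) : Prop :=
  Measurable w ∧ ∀ t : ℝ, 0 ≤ t → ‖w t‖ ≤ ω₀

/-- `‖w‖_∞ = sup_{t ≥ 0} ‖w(t)‖`. -/
noncomputable def supNorm {W : Type*} [NormedAddCommGroup W] (w : ℝ → W) : ℝ≥0 :=
  ⨆ t : ℝ≥0, ‖w t‖₊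

/-- Input-to-state practical stability, with respect to the disturbances bounded by `ω₀`, of the
system whose trajectories on `[0, ∞)` under the disturbance `w` are the `z` with `Traj w z`:
trajectories exist on `[0, ∞)` from every initial state, and all of them satisfy the
ISpS estimate. -/
def IsISpS {Z W : Type*} [NormedAddCommGroup Z] [NormedAddCommGroup W] [MeasurableSpace W]
    (ω₀ : ℝ) (Traj : (ℝ → W) → (ℝ → Z) → Prop) : Prop :=
  ∃ (β₁ : ℝ≥0 → ℝ≥0 → ℝ≥0) (β₂ : ℝ≥0 → ℝ≥0) (d : ℝ≥0), ClassKL β₁ ∧ ClassK β₂ ∧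
    ∀ w : ℝ → W, Admissible ω₀ w →
      (∀ z₀ : Z, ∃ z : ℝ → Z, z 0 = z₀ ∧ Traj w z) ∧
      ∀ z : ℝ → Z, Traj w z →
        ∀ t : ℝ≥0, ‖z t‖₊ ≤ β₁ ‖z 0‖₊ t + β₂ (supNorm w) + d

/-! ### Plant, observer, controller -/

/-- Data of the plant `ẋ = A x + B u + E p(q) + E_w w`, `y = C x + D u + F_w w`, `q = C_q x`. -/
structure Plant (nx nu ny nq np nw : ℕ) where
  A : Matrix (Fin nx) (Fin nx) ℝ
  B : Matrix (Fin nx) (Fin nu) ℝ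
  C : Matrix (Fin ny) (Fin nx) ℝ
  D : Matrix (Fin ny) (Fin nu) ℝ
  Cq : Matrix (Fin nq) (Fin nx) ℝ
  E : Matrix (Fin nx) (Fin np) ℝ
  Ew : Matrix (Fin nx) (Fin nw) ℝ
  Fw : Matrix (Fin ny) (Fin nw) ℝ
  p : EuclideanSpace ℝ (Fin nq) → EuclideanSpace ℝ (Fin np)

/-- Controller gains `K₁, K₂` and observer gains `L₁, L₂`. -/
structure Gains (nx nu ny nq np : ℕ) where
  K₁ : Matrix (Fin nu) (Fin nx) ℝ
  K₂ : Matrix (Fin nu) (Fin np) ℝ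
  L₁ : Matrix (Fin nq) (Fin ny) ℝ
  L₂ : Matrix (Fin nx) (Fin ny) ℝ

/-- Matrix acting on Euclidean vectors. -/
noncomputable def act {ι κ : Type*} [Fintype κ] (M : Matrix ι κ ℝ)
    (v : EuclideanSpace ℝ κ) : EuclideanSpace ℝ ι :=
  WithLp.toLp 2 (M.mulVec v.ofLp)

section
variable {nx nu ny nq np nw : ℕ}

/-- Right-hand side of the plant. -/
noncomputable def Plant.field (S : Plant nx nu ny nq np nw) (x : EuclideanSpace ℝ (Fin nx))
    (u : EuclideanSpace ℝ (Fin nu)) (w : EuclideanSpace ℝ (Fin nw)) :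
    EuclideanSpace ℝ (Fin nx) :=
  act S.A x + act S.B u + act S.E (S.p (act S.Cq x)) + act S.Ew w

/-- Measured output of the plant. -/
noncomputable def Plant.output (S : Plant nx nu ny nq np nw) (x : EuclideanSpace ℝ (Fin nx))
    (u : EuclideanSpace ℝ (Fin nu)) (w : EuclideanSpace ℝ (Fin nw)) :
    EuclideanSpace ℝ (Fin ny) :=
  act S.C x + act S.D u + act S.Fw w

/-- Output `ŷ` predicted by the observer. -/
noncomputable def Plant.predictedOutput (S : Plant nx nu ny nq np nw)
    (xh : EuclideanSpace ℝ (Fin nx)) (u : EuclideanSpace ℝ (Fin nu)) :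
    EuclideanSpace ℝ (Fin ny) :=
  act S.C xh + act S.D u

/-- Right-hand side of the observer, fed with the input `u` and the output information `y`. -/
noncomputable def observerField (S : Plant nx nu ny nq np nw) (G : Gains nx nu ny nq np)
    (xh : EuclideanSpace ℝ (Fin nx)) (u : EuclideanSpace ℝ (Fin nu))
    (y : EuclideanSpace ℝ (Fin ny)) : EuclideanSpace ℝ (Fin nx) :=
  act S.A xh + act S.B u
    + act S.E (S.p (act S.Cq xh + act G.L₁ (S.predictedOutput xh u - y)))
    + act G.L₂ (S.predictedOutput xh u - y)

/-- Feedback law `k(x̂) = K₁ x̂ + K₂ p(C_q x̂)`. -/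
noncomputable def feedback (S : Plant nx nu ny nq np nw) (G : Gains nx nu ny nq np)
    (xh : EuclideanSpace ℝ (Fin nx)) : EuclideanSpace ℝ (Fin nu) :=
  act G.K₁ xh + act G.K₂ (S.p (act S.Cq xh))

end

/-! ### The combined state `z = (x, e)`, `e = x - x̂` -/

/-- Combined state space `ℝ^{2 n_x}`, with the Euclidean norm. -/
abbrev State (nx : ℕ) : Type := EuclideanSpace ℝ (Fin nx ⊕ Fin nx)

/-- The column `(x, e)`. -/
noncomputable def stack {nx : ℕ} (x e : EuclideanSpace ℝ (Fin nx)) : State nx :=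
  WithLp.toLp 2 (Sum.elim x.ofLp e.ofLp)

/-- The plant state `x` in `z = (x, e)`. -/
noncomputable def State.plant {nx : ℕ} (z : State nx) : EuclideanSpace ℝ (Fin nx) :=
  WithLp.toLp 2 fun i => z (Sum.inl i)

/-- The estimation error `e` in `z = (x, e)`. -/
noncomputable def State.err {nx : ℕ} (z : State nx) : EuclideanSpace ℝ (Fin nx) :=
  WithLp.toLp 2 fun i => z (Sum.inr i)

/-- The observer state `x̂ = x - e`. -/
noncomputable def State.observer {nx : ℕ} (z : State nx) : EuclideanSpace ℝ (Fin nx) :=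
  State.plant z - State.err z

/-- `V(z) = zᵀ P z`. -/
noncomputable def quadForm {nx : ℕ} (P : Matrix (Fin nx ⊕ Fin nx) (Fin nx ⊕ Fin nx) ℝ)
    (z : State nx) : ℝ :=
  z.ofLp ⬝ᵥ P.mulVec z.ofLp

section
variable {nx nu ny nq np nw : ℕ}

/-- Right-hand side `ż = (ẋ, ẋ - d x̂/dt)` of the continuous-time closed loop, in which the
observer receives `y` and the plant and the observer receive `u = k(x̂)` at all times. -/
noncomputable def continuousLoopField (S : Plant nx nu ny nq np nw) (G : Gains nx nu ny nq np)
    (z : State nx) (w : EuclideanSpace ℝ (Fin nw)) : State nx :=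
  let x := State.plant z
  let xh := State.observer z
  let u := feedback S G xh
  stack (S.field x u w) (S.field x u w - observerField S G xh u (S.output x u w))

/-- Along the continuous-time closed loop, `V̇ ≤ -α₀ V + μ ‖w‖²` for `V(z) = zᵀ P z`, at every
state and every disturbance value of norm at most `ω₀`. -/
def DissipationInequality (S : Plant nx nu ny nq np nw) (G : Gains nx nu ny nq np)
    (P : Matrix (Fin nx ⊕ Fin nx) (Fin nx ⊕ Fin nx) ℝ) (α₀ μ ω₀ : ℝ) : Prop :=
  ∀ (z : State nx) (w : EuclideanSpace ℝ (Fin nw)), ‖w‖ ≤ ω₀ →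
    fderiv ℝ (quadForm P) z (continuousLoopField S G z w) ≤ -α₀ * quadForm P z + μ * ‖w‖ ^ 2

end

/-! ### Event-triggering mechanisms and the event-triggered closed loop -/

/-- Parameters of an event-triggering mechanism: dwell time `τ`, relative threshold `σ`,
absolute threshold `ε`. -/
structure Trigger where
  τ : ℝ
  σ : ℝ
  ε : ℝ

/-- A sample of a signal: the time at which it was taken and the value found then. -/
structure Sample (V : Type*) where
  time : ℝ
  value : V

/-- The next triggering time of a mechanism that holds the sample `h` and observes the signal `v`
from the time `r` on:
`inf {t ≥ r | t ≥ h.time + τ, ‖h.value - v(t)‖ > σ ‖v(t)‖ + ε}`, which is `∞` if the condition is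
never met. -/
noncomputable def Trigger.next {V : Type*} [NormedAddCommGroup V] (m : Trigger) (r : ℝ)
    (h : Sample V) (v : ℝ → V) : EReal :=
  sInf ((fun t : ℝ => (t : EReal)) ''
    {t : ℝ | r ≤ t ∧ h.time + m.τ ≤ t ∧ m.σ * ‖v t‖ + m.ε < ‖h.value - v t‖})

/-- `x` is a (locally absolutely continuous, Caratheodory) solution on `[r, ∞)` of `ẋ(t) = f(t)`. -/
def IsSolutionFrom {V : Type*} [NormedAddCommGroup V] [NormedSpace ℝ V] (r : ℝ)
    (x f : ℝ → V) : Prop :=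
  ∀ t : ℝ, r ≤ t → IntervalIntegrable f volume r t ∧ x t = x r + ∫ s in r..t, f s

section
variable {nx nu ny nq np nw : ℕ}

/-- `ζ` is a solution on `[r, ∞)` of the closed loop in which the observer receives the constant
held output `ys` and the input is `k(xs)` with the constant held observer state `xs`. -/
def IsHeldFlow (S : Plant nx nu ny nq np nw) (G : Gains nx nu ny nq np)
    (w : ℝ → EuclideanSpace ℝ (Fin nw)) (ys : EuclideanSpace ℝ (Fin ny))
    (xs : EuclideanSpace ℝ (Fin nx)) (r : ℝ) (ζ : ℝ → State nx) : Prop :=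
  IsSolutionFrom r (fun t => State.plant (ζ t))
    (fun t => S.field (State.plant (ζ t)) (feedback S G xs) (w t)) ∧
  IsSolutionFrom r (fun t => State.observer (ζ t))
    (fun t => observerField S G (State.observer (ζ t)) (feedback S G xs) ys)

/-- The output signal along `ζ` while the held observer state is `xs`. -/
noncomputable def outputAlong (S : Plant nx nu ny nq np nw) (G : Gains nx nu ny nq np)
    (w : ℝ → EuclideanSpace ℝ (Fin nw)) (xs : EuclideanSpace ℝ (Fin nx))
    (ζ : ℝ → State nx) (t : ℝ) : EuclideanSpace ℝ (Fin ny) :=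
  S.output (State.plant (ζ t)) (feedback S G xs) (w t)

/-- `z = (x, x - x̂)` is a trajectory on `[0, ∞)`, under the disturbance `w`, of the closed loop in
which the output is sent to the observer through the mechanism `my` and the observer state is
sent to the controller through the mechanism `mu`, each of them triggered by its own signal.

`s 0 = 0, s 1, s 2, …` are the successive times at which at least one of the two mechanisms
triggers (`∞` when there is no further triggering), and `hy n`, `hu n` are the samples held by the
two mechanisms from `s n` to `s (n+1)`. Whether a mechanism triggers is decided along the flow
`ζ n` that proceeds from `s n` with the samples currently held: the first of the two next
triggering times is `s (n+1)`; up to then the trajectory is `ζ n`; at that time each mechanism whose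
condition is met takes a new sample, and the other one keeps its own. -/
def IsETTrajectory (S : Plant nx nu ny nq np nw) (G : Gains nx nu ny nq np) (my mu : Trigger)
    (w : ℝ → EuclideanSpace ℝ (Fin nw)) (z : ℝ → State nx) : Prop :=
  ∃ (s : ℕ → EReal) (hy : ℕ → Sample (EuclideanSpace ℝ (Fin ny)))
    (hu : ℕ → Sample (EuclideanSpace ℝ (Fin nx))) (ζ : ℕ → ℝ → State nx),
    s 0 = 0 ∧
    hu 0 = ⟨0, State.observer (z 0)⟩ ∧
    hy 0 = ⟨0, outputAlong S G w (hu 0).value z 0⟩ ∧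
    ∀ (n : ℕ) (r : ℝ), s n = (r : EReal) →
      let y := outputAlong S G w (hu n).value (ζ n)
      let xh := fun t => State.observer (ζ n t)
      let nextY := my.next r (hy n) y
      let nextU := mu.next r (hu n) xh
      IsHeldFlow S G w (hy n).value (hu n).value r (ζ n) ∧
      s (n + 1) = min nextY nextU ∧
      (∀ t : ℝ, r ≤ t → (t : EReal) ≤ s (n + 1) → z t = ζ n t) ∧
      ∀ r' : ℝ, s (n + 1) = (r' : EReal) →
        hy (n + 1) = (if nextY ≤ nextU then ⟨r', y r'⟩ else hy n) ∧
        hu (n + 1) = (if nextU ≤ nextY then ⟨r', xh r'⟩ else hu n)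

end

end ETC

namespace ETC

/-! ### Integral equations -/

section Solutions
variable {E : Type*} [NormedAddCommGroup E] [NormedSpace ℝ E]

/-! Between triggerings the loop is the continuous-time loop perturbed by the sampling errors. Its
Lyapunov derivative gains at most a constant times `‖z‖` times these errors (`exists_loopBounds`).
Once a mechanism has passed its dwell time, its trigger keeps its error below a small multiple of
the signal plus a constant, which the decay `-α₀ V` absorbs. Within the dwell time nothing bounds
the error directly, so it is put into the Lyapunov function: `U = V(z) + φ(t - t_y) ‖x(t_y) - x‖² +
φ(t - t_u) ‖x̂(t_u) - x̂‖²`, where `φ` falls linearly from 1 to 0 over the dwell time `τ`. Its slope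
contributes `-τ⁻¹` times the squared error, which for small `τ` beats every term containing that
error. In both phases `U' ≤ -(α₀/2) U + q (ω + 1)²` (`quadratic_estimate`, `lyapunov_decrease`),
with `ω = ‖w‖_∞`; the 1 is the absolute threshold. The output mechanism is weighted by the error of
the plant state, not of the output: `w` is only measurable, so `y` need not be differentiable. The
output error is `C (x(t_y) - x)` plus a disturbance term bounded by `2 ‖F_w‖ ω`.

At a triggering `z` is continuous and the weighted error of the new sample is zero, so `U` does not
increase; since `D = 0`, a new input sample leaves the output error unchanged. Every triggering
advances the sum of the two sampling times by at least `τ`, so triggerings cannot accumulate and the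
estimate reaches every time (`Constants.quadForm_le_of_trajectory`). Comparing `V` with `‖z‖²` gives
the exponential bound. Existence follows flow by flow: with held samples, plant and observer are
globally Lipschitz equations with a bounded input (`exists_isSolutionFrom`). -/

theorem IsSolutionFrom.continuousOn {r : ℝ} {x f : ℝ → E} (h : IsSolutionFrom r x f) (T : ℝ) :
    ContinuousOn x (Icc r T) := by
  rcases lt_or_ge T r with hT | hT
  · simp [Icc_eq_empty_of_lt hT]
  have hc : ContinuousOn (fun t => x r + ∫ s in r..t, f s) (Icc r T) := by
    have h1 := (h T hT).1
    have h2 := intervalIntegral.continuousOn_primitive_interval' h1 left_mem_uIcc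
    rw [uIcc_of_le hT] at h2
    exact continuousOn_const.add h2
  exact hc.congr fun t ht => (h t ht.1).2

theorem IsSolutionFrom.lipschitzOnWith {r : ℝ} {x f : ℝ → E} (h : IsSolutionFrom r x f)
    {T : ℝ} {c : ℝ≥0} (hf : ∀ t ∈ Icc r T, ‖f t‖ ≤ c) : LipschitzOnWith c x (Icc r T) := by
  refine LipschitzOnWith.of_dist_le_mul fun s hs t ht => ?_
  have his := (h s hs.1).1
  have hit := (h t ht.1).1
  rw [dist_eq_norm, (h s hs.1).2, (h t ht.1).2, add_sub_add_left_eq_sub,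
    intervalIntegral.integral_interval_sub_left his hit, dist_eq_norm, Real.norm_eq_abs]
  refine intervalIntegral.norm_integral_le_of_norm_le_const fun u hu => hf u ?_
  have : uIcc t s ⊆ Icc r T := by
    rw [← uIcc_of_le (hs.1.trans hs.2)]
    exact uIcc_subset_uIcc (by rw [uIcc_of_le (hs.1.trans hs.2)]; exact ht)
      (by rw [uIcc_of_le (hs.1.trans hs.2)]; exact hs)
  exact this (uIoc_subset_uIcc hu)

/-- Lebesgue differentiation; the right-hand side is only integrable because `w` is merely
measurable. -/
theorem IsSolutionFrom.ae_hasDerivAt [CompleteSpace E] {r : ℝ} {x f : ℝ → E}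
    (h : IsSolutionFrom r x f) {T : ℝ} (hT : r ≤ T) :
    ∀ᵐ t, t ∈ Ioo r T → HasDerivAt x (f t) t := by
  filter_upwards [(h T hT).1.ae_hasDerivAt_integral] with t ht htm
  have h1 := ht (by rw [uIcc_of_le hT]; exact Ioo_subset_Icc_self htm) r left_mem_uIcc
  refine (h1.const_add (x r)).congr_of_eventuallyEq ?_
  filter_upwards [Ioo_mem_nhds htm.1 htm.2] with s hs
  exact (h s hs.1.le).2

/-- A globally Lipschitz vector field with a bounded measurable additive input has a solution on
`[r, ∞)` from every initial state. -/
theorem exists_isSolutionFrom [CompleteSpace E] {K : ℝ≥0} {f : E → E} (hf : LipschitzWith K f)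
    {g : ℝ → E} (hg : AEStronglyMeasurable g volume) {c r : ℝ} (hgc : ∀ t, r ≤ t → ‖g t‖ ≤ c)
    (x₀ : E) : ∃ x : ℝ → E, x r = x₀ ∧ IsSolutionFrom r x fun t => f (x t) + g t := by
  have hgi : ∀ t, r ≤ t → IntervalIntegrable g volume r t := by
    intro t ht
    rw [intervalIntegrable_iff_integrableOn_Ioc_of_le ht]
    refine Measure.integrableOn_of_bounded (M := c) (by simp) hg ?_
    filter_upwards [ae_restrict_mem measurableSet_Ioc] with s hs using hgc s hs.1.le
  -- the state is `exp (l (t - r)) • y t`, with `y` bounded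
  set l : ℝ := 2 * K + 1 with hl
  have hlpos : 0 < l := by positivity
  have hc0 : 0 ≤ c := (norm_nonneg _).trans (hgc r le_rfl)
  let X (y : BoundedContinuousFunction ℝ E) (s : ℝ) : E := Real.exp (l * (s - r)) • y s
  have hX : ∀ y, Continuous (X y) := fun y =>
    (Real.continuous_exp.comp (by fun_prop)).smul y.continuous
  have hXi : ∀ y t, r ≤ t → IntervalIntegrable (fun s => f (X y s) + g s) volume r t :=
    fun y t ht => ((hf.continuous.comp (hX y)).intervalIntegrable _ _).add (hgi t ht)
  have hexp : ∀ t, ∫ s in r..t, Real.exp (l * (s - r)) = (Real.exp (l * (t - r)) - 1) / l := by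
    intro t
    have : ∀ s ∈ uIcc r t,
        HasDerivAt (fun s => Real.exp (l * (s - r)) / l) (Real.exp (l * (s - r))) s := by
      intro s _
      have h1 : HasDerivAt (fun s => l * (s - r)) l s := by
        simpa using ((hasDerivAt_id s).sub_const r).const_mul l
      have h2 := h1.exp.div_const l
      rwa [mul_div_assoc, div_self hlpos.ne', mul_one] at h2
    rw [intervalIntegral.integral_eq_sub_of_hasDerivAt this
      (Continuous.intervalIntegrable (by fun_prop) _ _)]
    simp [sub_div]
  -- The Picard operator for `X y`, written in the weighted coordinate `y`. The exponential weight
  -- makes one contraction work on the whole half-line.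
  let J (y : BoundedContinuousFunction ℝ E) (t : ℝ) : E :=
    Real.exp (-(l * (t - r))) • (x₀ + ∫ s in r..t, (f (X y s) + g s))
  have hJc : ∀ y, ContinuousOn (J y) (Ici r) := by
    intro y
    refine ContinuousOn.smul (by fun_prop) (continuousOn_const.add ?_)
    intro t ht
    have h1 := intervalIntegral.continuousOn_primitive_interval' (hXi y (t + 1)
      ((mem_Ici.1 ht).trans (by linarith))) left_mem_uIcc
    rw [uIcc_of_le ((mem_Ici.1 ht).trans (by linarith))] at h1
    refine (h1 t ⟨ht, by linarith⟩).mono_of_mem_nhdsWithin ?_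
    filter_upwards [self_mem_nhdsWithin, mem_nhdsWithin_of_mem_nhds (Iio_mem_nhds
      (show t < t + 1 by linarith))] with s hs hs' using ⟨hs, le_of_lt hs'⟩
  -- Integrating the weight gives the factor `K / l * (1 - exp (-(l (t - r))))`, at most `1 / 2`
  -- because `l = 2 K + 1`.
  have hJdiff : ∀ y y' t, r ≤ t → ‖J y t - J y' t‖ ≤ 1 / 2 * dist y y' := by
    intro y y' t ht
    have hd : J y t - J y' t
        = Real.exp (-(l * (t - r))) • ∫ s in r..t, (f (X y s) - f (X y' s)) := by
      simp only [J]
      rw [← smul_sub, add_sub_add_left_eq_sub, ← intervalIntegral.integral_sub (hXi y t ht)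
        (hXi y' t ht)]
      simp
    have hb : ‖∫ s in r..t, (f (X y s) - f (X y' s))‖
        ≤ ∫ s in r..t, K * dist y y' * Real.exp (l * (s - r)) := by
      refine intervalIntegral.norm_integral_le_of_norm_le ht ?_
        (Continuous.intervalIntegrable (by fun_prop) _ _)
      refine Eventually.of_forall fun s _ => ?_
      rw [← dist_eq_norm]
      refine (hf.dist_le_mul _ _).trans ?_
      rw [mul_assoc]
      gcongr
      rw [dist_eq_norm]
      simp only [X]
      rw [← smul_sub, norm_smul, Real.norm_of_nonneg (Real.exp_pos _).le, mul_comm]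
      gcongr
      rw [← dist_eq_norm]
      exact y.dist_coe_le_dist s
    rw [intervalIntegral.integral_const_mul, hexp] at hb
    rw [hd, norm_smul, Real.norm_of_nonneg (Real.exp_pos _).le]
    calc _ ≤ Real.exp (-(l * (t - r))) * (K * dist y y' * ((Real.exp (l * (t - r)) - 1) / l)) := by
          gcongr
      _ = K / l * dist y y' * (1 - Real.exp (-(l * (t - r)))) := by
          have : Real.exp (-(l * (t - r))) * Real.exp (l * (t - r)) = 1 := by
            rw [← Real.exp_add]; simp
          field_simp
          linear_combination (dist y y' * K) * this
      _ ≤ 1 / 2 * dist y y' * 1 := by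
          have h1 : (K : ℝ) / l ≤ 1 / 2 := by
            rw [div_le_div_iff₀ hlpos two_pos]; linarith
          have h2 : 1 - Real.exp (-(l * (t - r))) ≤ 1 := by linarith [Real.exp_pos (-(l * (t - r)))]
          have h3 : 0 ≤ 1 - Real.exp (-(l * (t - r))) := by
            have : Real.exp (-(l * (t - r))) ≤ 1 :=
              Real.exp_le_one_iff.2 (by nlinarith)
            linarith
          gcongr
      _ = _ := by ring
  -- Boundedness of one image, hence with the contraction estimate of all of them. The linear growth
  -- of the integral is tamed by `s exp (-(l s)) ≤ 1 / l`.
  have hJ0 : ∀ t, r ≤ t → ‖J 0 t‖ ≤ ‖x₀‖ + (‖f 0‖ + c) / l := by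
    intro t ht
    have he : Real.exp (-(l * (t - r))) ≤ 1 := Real.exp_le_one_iff.2 (by nlinarith)
    have hb : ‖∫ s in r..t, (f (X 0 s) + g s)‖ ≤ (‖f 0‖ + c) * |t - r| := by
      refine intervalIntegral.norm_integral_le_of_norm_le_const fun s hs => ?_
      rw [uIoc_of_le ht] at hs
      refine (norm_add_le _ _).trans (add_le_add ?_ (hgc s hs.1.le))
      simp [X]
    rw [abs_of_nonneg (by linarith)] at hb
    simp only [J]
    rw [norm_smul, Real.norm_of_nonneg (Real.exp_pos _).le]
    have h1 : Real.exp (-(l * (t - r))) * (t - r) ≤ 1 / l := by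
      rw [Real.exp_neg, inv_mul_le_iff₀ (Real.exp_pos _), mul_one_div, le_div_iff₀ hlpos]
      linarith [Real.add_one_le_exp (l * (t - r))]
    calc _ ≤ Real.exp (-(l * (t - r))) * (‖x₀‖ + (‖f 0‖ + c) * (t - r)) := by
          gcongr; exact (norm_add_le _ _).trans (by gcongr)
      _ = Real.exp (-(l * (t - r))) * ‖x₀‖
          + (‖f 0‖ + c) * (Real.exp (-(l * (t - r))) * (t - r)) := by ring
      _ ≤ 1 * ‖x₀‖ + (‖f 0‖ + c) * (1 / l) := by gcongr
      _ = _ := by ring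
  -- Freezing the time at `r` to the left of `r` gives a function on all of `ℝ`; only times from `r`
  -- on matter.
  let Φ (y : BoundedContinuousFunction ℝ E) : BoundedContinuousFunction ℝ E :=
    BoundedContinuousFunction.ofNormedAddCommGroup (fun t => J y (max r t))
      ((hJc y).comp_continuous (by fun_prop) fun t => le_max_left r t)
      (1 / 2 * dist y 0 + (‖x₀‖ + (‖f 0‖ + c) / l)) (by
        intro t
        have h1 := hJdiff y 0 _ (le_max_left r t)
        have h2 := hJ0 _ (le_max_left r t)
        calc ‖J y (max r t)‖ = ‖(J y (max r t) - J 0 (max r t)) + J 0 (max r t)‖ := by simp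
          _ ≤ _ := (norm_add_le _ _).trans (add_le_add h1 h2))
  have hΦ : ContractingWith (1 / 2) Φ := by
    refine ⟨by rw [← NNReal.coe_lt_coe]; norm_num, LipschitzWith.of_dist_le_mul fun y y' => ?_⟩
    rw [BoundedContinuousFunction.dist_le (by positivity)]
    intro t
    rw [dist_eq_norm]
    simpa [Φ] using hJdiff y y' _ (le_max_left r t)
  obtain ⟨y, hy⟩ : ∃ y, Φ y = y := ⟨_, hΦ.fixedPoint_isFixedPt⟩
  have hyt : ∀ t, r ≤ t → X y t = x₀ + ∫ s in r..t, (f (X y s) + g s) := by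
    intro t ht
    have h1 : y t = J y t := by
      conv_lhs => rw [← hy]
      simp [Φ, max_eq_right ht]
    have : X y t = Real.exp (l * (t - r)) • J y t := by simp only [X, h1]
    rw [this]
    simp only [J]
    rw [smul_smul, ← Real.exp_add]
    simp
  have hyr : X y r = x₀ := by simpa using hyt r le_rfl
  exact ⟨X y, hyr, fun t ht => ⟨hXi y t ht, by rw [hyr]; exact hyt t ht⟩⟩

end Solutions

/-! ### Absolutely continuous functions -/

section AbsolutelyContinuous
variable {E : Type*} [NormedAddCommGroup E]

theorem absolutelyContinuous_norm_sq {f : ℝ → E} {a b : ℝ} {K : ℝ≥0}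
    (hf : LipschitzOnWith K f (uIcc a b)) :
    AbsolutelyContinuousOnInterval (fun t => ‖f t‖ ^ 2) a b := by
  have h : AbsolutelyContinuousOnInterval (fun t => ‖f t‖) a b :=
    ((lipschitzWith_one_norm (E := E)).comp_lipschitzOnWith hf).absolutelyContinuousOnInterval
  simpa only [sq] using h.fun_mul h

/-- Polarization reduces inner products to squared norms. -/
theorem absolutelyContinuous_inner [InnerProductSpace ℝ E] {f g : ℝ → E} {a b : ℝ} {K L : ℝ≥0}
    (hf : LipschitzOnWith K f (uIcc a b)) (hg : LipschitzOnWith L g (uIcc a b)) :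
    AbsolutelyContinuousOnInterval (fun t => inner ℝ (f t) (g t)) a b := by
  have h1 := absolutelyContinuous_norm_sq (hf.add hg)
  have h2 := absolutelyContinuous_norm_sq (hf.sub hg)
  have h3 := (h1.fun_sub h2).const_mul (1 / 4)
  refine (funext fun t => ?_ : (fun t => inner ℝ (f t) (g t)) = _) ▸ h3
  rw [norm_add_sq_real, norm_sub_sq_real]
  ring

/-- Comparison with the solution of `u' = -α (u - κ)`. -/
theorem comparison_of_ae_deriv_le {u : ℝ → ℝ} {a b α κ : ℝ} (hab : a ≤ b)
    (hu : AbsolutelyContinuousOnInterval u a b)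
    (hd : ∀ᵐ t, t ∈ Ioo a b → ∃ u', HasDerivAt u u' t ∧ u' ≤ -α * (u t - κ)) :
    (u b - κ) * Real.exp (α * b) ≤ (u a - κ) * Real.exp (α * a) := by
  have hexp : AbsolutelyContinuousOnInterval (fun t => Real.exp (α * t)) a b := by
    apply ContDiffOn.absolutelyContinuousOnInterval
    fun_prop
  have hk : AbsolutelyContinuousOnInterval (fun _ : ℝ => κ) a b :=
    (LipschitzWith.const κ).lipschitzOnWith.absolutelyContinuousOnInterval
  -- The product `(u - κ) exp (α t)` is absolutely continuous with derivative `≤ 0` almost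
  -- everywhere, hence does not increase.
  have h := ((hu.fun_sub hk).fun_mul hexp).integral_deriv_eq_sub
  have hle : ∫ t in a..b, deriv (fun t => (u t - κ) * Real.exp (α * t)) t ≤ 0 := by
    rw [intervalIntegral.integral_of_le hab, integral_Ioc_eq_integral_Ioo]
    refine setIntegral_nonpos_ae measurableSet_Ioo ?_
    filter_upwards [hd] with t ht htm
    obtain ⟨u', hu', hle⟩ := ht htm
    have h1 : HasDerivAt (fun t => Real.exp (α * t)) (Real.exp (α * t) * α) t := by
      simpa using ((hasDerivAt_id t).const_mul α).exp
    rw [((hu'.sub_const κ).fun_mul h1).deriv]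
    nlinarith [Real.exp_pos (α * t)]
  linarith

end AbsolutelyContinuous

/-! ### Matrices acting on Euclidean vectors -/

/-- `act M` as a continuous linear map. -/
noncomputable def actCLM {ι κ : Type*} [Fintype ι] [Fintype κ] (M : Matrix ι κ ℝ) :
    EuclideanSpace ℝ κ →L[ℝ] EuclideanSpace ℝ ι :=
  LinearMap.toContinuousLinearMap
    { toFun := act M
      map_add' := fun v w => by ext i; simp [act, Matrix.mulVec_add]
      map_smul' := fun c v => by ext i; simp [act, Matrix.mulVec_smul] }

theorem actCLM_apply {ι κ : Type*} [Fintype ι] [Fintype κ] (M : Matrix ι κ ℝ)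
    (v : EuclideanSpace ℝ κ) : actCLM M v = act M v := rfl

theorem lipschitz_act {ι κ : Type*} [Fintype ι] [Fintype κ] (M : Matrix ι κ ℝ) :
    LipschitzWith ‖actCLM M‖₊ (act M) := (actCLM M).lipschitz

theorem act_zero {ι κ : Type*} [Fintype ι] [Fintype κ] (M : Matrix ι κ ℝ) :
    act M 0 = 0 := (actCLM M).map_zero

theorem zero_act {ι κ : Type*} [Fintype κ] (v : EuclideanSpace ℝ κ) :
    act (0 : Matrix ι κ ℝ) v = 0 := by ext i; simp [act]

section Stack
variable {nx : ℕ}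

/-- Stacking two columns as a continuous linear map. -/
noncomputable def stackCLM :
    (EuclideanSpace ℝ (Fin nx) × EuclideanSpace ℝ (Fin nx)) →L[ℝ] State nx :=
  LinearMap.toContinuousLinearMap
    { toFun := fun v => stack v.1 v.2
      map_add' := fun v w => by ext i; cases i <;> simp [stack]
      map_smul' := fun c v => by ext i; cases i <;> simp [stack] }

theorem stackCLM_apply (x e : EuclideanSpace ℝ (Fin nx)) : stackCLM (x, e) = stack x e := rfl

theorem plant_stack (x e : EuclideanSpace ℝ (Fin nx)) : State.plant (stack x e) = x := rfl

theorem err_stack (x e : EuclideanSpace ℝ (Fin nx)) : State.err (stack x e) = e := rfl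

theorem observer_stack (x xh : EuclideanSpace ℝ (Fin nx)) :
    State.observer (stack x (x - xh)) = xh := by
  rw [State.observer, plant_stack, err_stack, sub_sub_cancel]

theorem stack_plant_observer (z : State nx) :
    stack (State.plant z) (State.plant z - State.observer z) = z := by
  ext i; cases i <;> simp [stack, State.plant, State.observer, State.err]

theorem norm_stack_sq (x e : EuclideanSpace ℝ (Fin nx)) :
    ‖stack x e‖ ^ 2 = ‖x‖ ^ 2 + ‖e‖ ^ 2 := by
  simp [EuclideanSpace.norm_sq_eq, stack]

theorem norm_sq_eq_plant_add_err (z : State nx) :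
    ‖z‖ ^ 2 = ‖State.plant z‖ ^ 2 + ‖State.err z‖ ^ 2 := by
  simp [EuclideanSpace.norm_sq_eq, State.plant, State.err]

theorem norm_stack_le (x e : EuclideanSpace ℝ (Fin nx)) : ‖stack x e‖ ≤ ‖x‖ + ‖e‖ := by
  refine abs_le_of_sq_le_sq' ?_ (by positivity) |>.2
  rw [norm_stack_sq]
  nlinarith [mul_nonneg (norm_nonneg x) (norm_nonneg e)]

theorem norm_plant_le (z : State nx) : ‖State.plant z‖ ≤ ‖z‖ := by
  refine abs_le_of_sq_le_sq' ?_ (by positivity) |>.2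
  rw [norm_sq_eq_plant_add_err z]
  nlinarith [sq_nonneg ‖State.err z‖]

theorem norm_err_le (z : State nx) : ‖State.err z‖ ≤ ‖z‖ := by
  refine abs_le_of_sq_le_sq' ?_ (by positivity) |>.2
  rw [norm_sq_eq_plant_add_err z]
  nlinarith [sq_nonneg ‖State.plant z‖]

theorem norm_observer_le (z : State nx) : ‖State.observer z‖ ≤ 2 * ‖z‖ := by
  have := norm_sub_le (State.plant z) (State.err z)
  have := norm_plant_le z
  have := norm_err_le z
  rw [State.observer]
  linarith

end Stack

/-! ### The quadratic form -/

section QuadForm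
variable {nx : ℕ} (P : Matrix (Fin nx ⊕ Fin nx) (Fin nx ⊕ Fin nx) ℝ)

theorem quadForm_eq_inner (z : State nx) : quadForm P z = inner ℝ z (act P z) := by
  simp [quadForm, act, EuclideanSpace.inner_eq_star_dotProduct, dotProduct_comm]

theorem quadForm_le (z : State nx) : quadForm P z ≤ ‖actCLM P‖ * ‖z‖ ^ 2 := by
  rw [quadForm_eq_inner]
  refine (real_inner_le_norm _ _).trans ?_
  have := (actCLM P).le_opNorm z
  rw [actCLM_apply] at this
  nlinarith [norm_nonneg z]

theorem differentiable_quadForm : Differentiable ℝ (quadForm P) := by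
  have : quadForm P = fun z : State nx => inner ℝ z (actCLM P z) :=
    funext fun z => quadForm_eq_inner P z
  rw [this]
  exact Differentiable.inner ℝ differentiable_id (actCLM P).differentiable

theorem fderiv_quadForm_apply (z v : State nx) :
    fderiv ℝ (quadForm P) z v = inner ℝ z (act P v) + inner ℝ v (act P z) := by
  have : quadForm P = fun z : State nx => inner ℝ z (actCLM P z) :=
    funext fun z => quadForm_eq_inner P z
  rw [this]
  refine (fderiv_inner_apply ℝ (f := fun z : State nx => z) differentiableAt_fun_id
    (actCLM P).differentiableAt v).trans ?_
  simp [actCLM_apply]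

theorem fderiv_quadForm_le (z v : State nx) :
    fderiv ℝ (quadForm P) z v ≤ 2 * ‖actCLM P‖ * ‖z‖ * ‖v‖ := by
  rw [fderiv_quadForm_apply]
  have h1 := real_inner_le_norm z (act P v)
  have h2 := real_inner_le_norm v (act P z)
  have h3 := (actCLM P).le_opNorm z
  have h4 := (actCLM P).le_opNorm v
  rw [actCLM_apply] at h3 h4
  have h5 := mul_le_mul_of_nonneg_left h4 (norm_nonneg z)
  have h6 := mul_le_mul_of_nonneg_left h3 (norm_nonneg v)
  linarith

variable {P}

theorem quadForm_pos (hP : P.PosDef) {z : State nx} (hz : z ≠ 0) : 0 < quadForm P z := by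
  have := hP.dotProduct_mulVec_pos (x := z.ofLp) (by simpa using hz)
  simpa [quadForm] using this

/-- The constant is the minimum of the form on the compact unit sphere; homogeneity of degree two
does the rest. The sphere is empty when the state space is trivial. -/
theorem exists_mul_norm_sq_le_quadForm (hP : P.PosDef) :
    ∃ m : ℝ, 0 < m ∧ ∀ z : State nx, m * ‖z‖ ^ 2 ≤ quadForm P z := by
  rcases (Metric.sphere (0 : State nx) 1).eq_empty_or_nonempty with he | hne
  · refine ⟨1, one_pos, fun z => ?_⟩
    have hz : z = 0 := by
      by_contra hz
      have : (‖z‖⁻¹ • z) ∈ Metric.sphere (0 : State nx) 1 := by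
        simp [norm_smul, hz]
      simp [he] at this
    subst hz
    simp [quadForm]
  · obtain ⟨z₀, hz₀, hmin⟩ := (isCompact_sphere (0 : State nx) 1).exists_isMinOn hne
      (differentiable_quadForm P).continuous.continuousOn
    have hz₀' : z₀ ≠ 0 := by
      rintro rfl
      simp at hz₀
    refine ⟨quadForm P z₀, quadForm_pos hP hz₀', fun z => ?_⟩
    by_cases hz : z = 0
    · subst hz; simp [quadForm]
    have h1 : quadForm P z₀ ≤ quadForm P (‖z‖⁻¹ • z) := hmin (by simp [norm_smul, hz])
    have h2 : quadForm P (‖z‖⁻¹ • z) = (‖z‖ ^ 2)⁻¹ * quadForm P z := by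
      simp [quadForm, Matrix.mulVec_smul, sq]; ring
    rw [h2, ← div_eq_inv_mul, le_div_iff₀ (by positivity)] at h1
    exact h1

end QuadForm

/-! ### Lipschitz continuity of the plant, the observer and the feedback -/

section Lipschitz
variable {nx nu ny nq np nw : ℕ} {S : Plant nx nu ny nq np nw} (G : Gains nx nu ny nq np)

theorem exists_lipschitz_field (hp : ∃ ℓ : ℝ≥0, LipschitzWith ℓ S.p) :
    ∃ K : ℝ≥0, LipschitzWith K fun q : EuclideanSpace ℝ (Fin nx) ×
      EuclideanSpace ℝ (Fin nu) × EuclideanSpace ℝ (Fin nw) => S.field q.1 q.2.1 q.2.2 := by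
  obtain ⟨ℓ, hp⟩ := hp
  have h1 := LipschitzWith.prod_fst (α := EuclideanSpace ℝ (Fin nx))
    (β := EuclideanSpace ℝ (Fin nu) × EuclideanSpace ℝ (Fin nw))
  have h2 := LipschitzWith.prod_snd (α := EuclideanSpace ℝ (Fin nx))
    (β := EuclideanSpace ℝ (Fin nu) × EuclideanSpace ℝ (Fin nw))
  exact ⟨_, ((((lipschitz_act S.A).comp h1).add
    ((lipschitz_act S.B).comp (LipschitzWith.prod_fst.comp h2))).add
    ((lipschitz_act S.E).comp (hp.comp ((lipschitz_act S.Cq).comp h1)))).add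
    ((lipschitz_act S.Ew).comp (LipschitzWith.prod_snd.comp h2))⟩

theorem exists_lipschitz_feedback (hp : ∃ ℓ : ℝ≥0, LipschitzWith ℓ S.p) :
    ∃ K : ℝ≥0, LipschitzWith K (feedback S G) := by
  obtain ⟨ℓ, hp⟩ := hp
  exact ⟨_, (lipschitz_act G.K₁).add
    ((lipschitz_act G.K₂).comp (hp.comp (lipschitz_act S.Cq)))⟩

theorem exists_lipschitz_observerField (hp : ∃ ℓ : ℝ≥0, LipschitzWith ℓ S.p) :
    ∃ K : ℝ≥0, LipschitzWith K fun q : EuclideanSpace ℝ (Fin nx) ×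
      EuclideanSpace ℝ (Fin nu) × EuclideanSpace ℝ (Fin ny) =>
        observerField S G q.1 q.2.1 q.2.2 := by
  obtain ⟨ℓ, hp⟩ := hp
  have h1 := LipschitzWith.prod_fst (α := EuclideanSpace ℝ (Fin nx))
    (β := EuclideanSpace ℝ (Fin nu) × EuclideanSpace ℝ (Fin ny))
  have h2 := LipschitzWith.prod_snd (α := EuclideanSpace ℝ (Fin nx))
    (β := EuclideanSpace ℝ (Fin nu) × EuclideanSpace ℝ (Fin ny))
  have hu := LipschitzWith.prod_fst.comp h2
  have hy := LipschitzWith.prod_snd.comp h2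
  have hi := (((lipschitz_act S.C).comp h1).add ((lipschitz_act S.D).comp hu)).sub hy
  exact ⟨_, ((((lipschitz_act S.A).comp h1).add ((lipschitz_act S.B).comp hu)).add
    ((lipschitz_act S.E).comp (hp.comp (((lipschitz_act S.Cq).comp h1).add
      ((lipschitz_act G.L₁).comp hi))))).add ((lipschitz_act G.L₂).comp hi)⟩

variable {G}

theorem field_zero (hp0 : S.p 0 = 0) : S.field 0 0 0 = 0 := by
  simp [Plant.field, act_zero, hp0]

theorem feedback_zero (hp0 : S.p 0 = 0) : feedback S G 0 = 0 := by
  simp [feedback, act_zero, hp0]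

theorem observerField_zero (hp0 : S.p 0 = 0) : observerField S G 0 0 0 = 0 := by
  simp [observerField, Plant.predictedOutput, act_zero, hp0]

theorem output_eq (hD : S.D = 0) (x : EuclideanSpace ℝ (Fin nx)) (u : EuclideanSpace ℝ (Fin nu))
    (w : EuclideanSpace ℝ (Fin nw)) : S.output x u w = act S.C x + act S.Fw w := by
  simp [Plant.output, hD, zero_act]

theorem field_add (x : EuclideanSpace ℝ (Fin nx)) (u : EuclideanSpace ℝ (Fin nu))
    (w : EuclideanSpace ℝ (Fin nw)) : S.field x u w = S.field x u 0 + act S.Ew w := by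
  simp [Plant.field, act_zero]

end Lipschitz

/-! ### The closed loop with held samples as a perturbation of the continuous-time loop -/

section Bounds
variable {nx nu ny nq np nw : ℕ}

/-- With held samples `xs` and `ys`, the closed loop deviates from the continuous-time loop by at
most `c` times the sampling errors, and its velocity is bounded by `c` times the state, the
sampling errors and the disturbance. -/
def LoopBounds (S : Plant nx nu ny nq np nw) (G : Gains nx nu ny nq np)
    (P : Matrix (Fin nx ⊕ Fin nx) (Fin nx ⊕ Fin nx) ℝ) (α₀ μ ω₀ c : ℝ) : Prop :=
  ∀ (z : State nx) (xs : EuclideanSpace ℝ (Fin nx))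
    (ys : EuclideanSpace ℝ (Fin ny)) (w : EuclideanSpace ℝ (Fin nw)), ‖w‖ ≤ ω₀ →
    let x := State.plant z
    let xh := State.observer z
    let dx := S.field x (feedback S G xs) w
    let dh := observerField S G xh (feedback S G xs) ys
    let au := ‖xs - xh‖
    let ay := ‖ys - S.output x (feedback S G xs) w‖
    fderiv ℝ (quadForm P) z (stack dx (dx - dh)) ≤
        -α₀ * quadForm P z + μ * ‖w‖ ^ 2 + c * ‖z‖ * (au + ay) ∧
      ‖dx‖ ≤ c * (‖z‖ + au + ‖w‖) ∧ ‖dh‖ ≤ c * (‖z‖ + au + ay + ‖w‖)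

theorem LoopBounds.mono {S : Plant nx nu ny nq np nw} {G : Gains nx nu ny nq np}
    {P : Matrix (Fin nx ⊕ Fin nx) (Fin nx ⊕ Fin nx) ℝ} {α₀ μ ω₀ c c' : ℝ}
    (h : LoopBounds S G P α₀ μ ω₀ c) (hc : c ≤ c') : LoopBounds S G P α₀ μ ω₀ c' := by
  intro z xs ys w hw
  obtain ⟨h1, h2, h3⟩ := h z xs ys w hw
  refine ⟨h1.trans ?_, h2.trans ?_, h3.trans ?_⟩ <;> gcongr

/-- All fields are globally Lipschitz, so replacing current signals by held samples changes the
velocity by a multiple of the sampling errors, and the gradient of `V` is at most `2 ‖P‖ ‖z‖`. The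
velocity bounds have no constant term because `p 0 = 0`. -/
theorem exists_loopBounds (S : Plant nx nu ny nq np nw) (G : Gains nx nu ny nq np)
    (P : Matrix (Fin nx ⊕ Fin nx) (Fin nx ⊕ Fin nx) ℝ) {α₀ μ ω₀ : ℝ}
    (hD : S.D = 0) (hp0 : S.p 0 = 0) (hp : ∃ ℓ : ℝ≥0, LipschitzWith ℓ S.p)
    (hV : DissipationInequality S G P α₀ μ ω₀) :
    ∃ c : ℝ, LoopBounds S G P α₀ μ ω₀ c := by
  obtain ⟨Kf, hKf⟩ := exists_lipschitz_field hp
  obtain ⟨Kk, hKk⟩ := exists_lipschitz_feedback G hp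
  obtain ⟨Ko, hKo⟩ := exists_lipschitz_observerField G hp
  have hf : ∀ x u w x' u' w', ‖S.field x u w - S.field x' u' w'‖
      ≤ Kf * (‖x - x'‖ + ‖u - u'‖ + ‖w - w'‖) := by
    intro x u w x' u' w'
    have h := hKf.dist_le_mul (x, u, w) (x', u', w')
    simp only [dist_eq_norm, Prod.mk_sub_mk, Prod.norm_mk] at h
    refine h.trans (mul_le_mul_of_nonneg_left ?_ Kf.coe_nonneg)
    have := norm_nonneg (x - x')
    have := norm_nonneg (u - u')
    have := norm_nonneg (w - w')
    simp only [max_le_iff]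
    refine ⟨?_, ?_, ?_⟩ <;> linarith
  have ho : ∀ x u w x' u' w', ‖observerField S G x u w - observerField S G x' u' w'‖
      ≤ Ko * (‖x - x'‖ + ‖u - u'‖ + ‖w - w'‖) := by
    intro x u w x' u' w'
    have h := hKo.dist_le_mul (x, u, w) (x', u', w')
    simp only [dist_eq_norm, Prod.mk_sub_mk, Prod.norm_mk] at h
    refine h.trans (mul_le_mul_of_nonneg_left ?_ Ko.coe_nonneg)
    have := norm_nonneg (x - x')
    have := norm_nonneg (u - u')
    have := norm_nonneg (w - w')
    simp only [max_le_iff]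
    refine ⟨?_, ?_, ?_⟩ <;> linarith
  have hk : ∀ x x', ‖feedback S G x - feedback S G x'‖ ≤ Kk * ‖x - x'‖ := by
    intro x x'
    simpa only [dist_eq_norm] using hKk.dist_le_mul x x'
  set pn : ℝ := ‖actCLM P‖
  set cn : ℝ := ‖actCLM S.C‖
  set fn : ℝ := ‖actCLM S.Fw‖
  have hpn : 0 ≤ pn := norm_nonneg _
  have hcn : 0 ≤ cn := norm_nonneg _
  have hfn : 0 ≤ fn := norm_nonneg _
  have hKf0 := Kf.coe_nonneg
  have hKk0 := Kk.coe_nonneg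
  have hKo0 := Ko.coe_nonneg
  -- `c₁` is the gradient bound times the deviation of the stacked velocity, in which the plant
  -- deviation occurs twice; `c₂` and `c₃` bound the plant and observer velocities. They are
  -- generous; only their existence matters.
  set c₁ : ℝ := 2 * pn * ((2 * Kf + Ko) * Kk + Ko) with hc₁
  set c₂ : ℝ := Kf * (1 + 2 * Kk) + Kf * Kk + Kf with hc₂
  set c₃ : ℝ := Ko * (2 + 2 * Kk + cn) + Ko * Kk + Ko + Ko * fn with hc₃
  have hc₁0 : 0 ≤ c₁ := by positivity
  have hc₂0 : 0 ≤ c₂ := by positivity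
  have hc₃0 : 0 ≤ c₃ := by positivity
  refine ⟨c₁ + c₂ + c₃, fun z xs ys w hw => ?_⟩
  intro x xh dx dh au ay
  have hau : 0 ≤ au := norm_nonneg _
  have hay : 0 ≤ ay := norm_nonneg _
  have hz := norm_nonneg z
  have hw0 := norm_nonneg w
  have hx : ‖x‖ ≤ ‖z‖ := norm_plant_le z
  have hxh : ‖xh‖ ≤ 2 * ‖z‖ := norm_observer_le z
  have hkd : ‖feedback S G xs - feedback S G xh‖ ≤ Kk * au := hk _ _
  have hkn : ‖feedback S G xs‖ ≤ Kk * au + Kk * (2 * ‖z‖) := by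
    have h1 := hk xh 0
    rw [feedback_zero hp0, sub_zero, sub_zero] at h1
    have h2 := norm_add_le (feedback S G xs - feedback S G xh) (feedback S G xh)
    rw [sub_add_cancel] at h2
    have h3 := mul_le_mul_of_nonneg_left hxh hKk0
    linarith
  have hyn : ‖ys‖ ≤ ay + cn * ‖z‖ + fn * ‖w‖ := by
    have h1 := norm_add_le (ys - S.output x (feedback S G xs) w) (S.output x (feedback S G xs) w)
    rw [sub_add_cancel, output_eq hD] at h1
    have h2 := norm_add_le (act S.C x) (act S.Fw w)
    have h3 := (actCLM S.C).le_opNorm x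
    have h4 := (actCLM S.Fw).le_opNorm w
    rw [actCLM_apply] at h3 h4
    have h5 := mul_le_mul_of_nonneg_left hx hcn
    have h6 : ay = ‖ys - (act S.C x + act S.Fw w)‖ := by simp only [ay, output_eq hD]
    linarith
  have hdx : ‖dx‖ ≤ c₂ * (‖z‖ + au + ‖w‖) := by
    have h1 := hf x (feedback S G xs) w 0 0 0
    rw [field_zero hp0] at h1
    simp only [sub_zero] at h1
    refine h1.trans ((mul_le_mul_of_nonneg_left (add_le_add_left (add_le_add hx hkn) _)
      hKf0).trans ?_)
    have : 0 ≤ Kf * Kk * ‖z‖ + Kf * ‖z‖ + 2 * Kf * Kk * au + 2 * Kf * au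
      + (3 * Kf * Kk + Kf) * ‖w‖ := by positivity
    rw [hc₂]
    nlinarith
  have hdh : ‖dh‖ ≤ c₃ * (‖z‖ + au + ay + ‖w‖) := by
    have h1 := ho xh (feedback S G xs) ys 0 0 0
    rw [observerField_zero hp0] at h1
    simp only [sub_zero] at h1
    refine h1.trans ((mul_le_mul_of_nonneg_left (add_le_add (add_le_add hxh hkn) hyn)
      hKo0).trans ?_)
    have h2 : 0 ≤ (Ko * Kk + Ko + Ko * fn) * ‖z‖
      + (Ko * (2 + 2 * Kk + cn) + Ko + Ko * fn) * au
      + (Ko * (2 + 2 * Kk + cn) + Ko * Kk + Ko * fn) * ay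
      + (Ko * (2 + 2 * Kk + cn) + Ko * Kk + Ko) * ‖w‖ := by positivity
    rw [hc₃]
    linarith
  refine ⟨?_, hdx.trans ?_, hdh.trans ?_⟩
  · have hdec : stack dx (dx - dh) = continuousLoopField S G z w
        + stack (dx - S.field x (feedback S G xh) w)
          ((dx - S.field x (feedback S G xh) w)
            - (dh - observerField S G xh (feedback S G xh)
                (S.output x (feedback S G xh) w))) := by
      simp only [continuousLoopField]
      rw [← stackCLM_apply, ← stackCLM_apply, ← stackCLM_apply, ← map_add, Prod.mk_add_mk]
      congr 2 <;> abel
    rw [hdec, map_add]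
    have h1 := hV z w hw
    have h2 := fderiv_quadForm_le P z (stack (dx - S.field x (feedback S G xh) w)
          ((dx - S.field x (feedback S G xh) w)
            - (dh - observerField S G xh (feedback S G xh)
                (S.output x (feedback S G xh) w))))
    have h3 : ‖dx - S.field x (feedback S G xh) w‖ ≤ Kf * (Kk * au) := by
      have := hf x (feedback S G xs) w x (feedback S G xh) w
      simp only [sub_self, norm_zero, zero_add, add_zero] at this
      exact this.trans (mul_le_mul_of_nonneg_left hkd hKf0)
    have h4 : ‖dh - observerField S G xh (feedback S G xh) (S.output x (feedback S G xh) w)‖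
        ≤ Ko * (Kk * au + ay) := by
      have := ho xh (feedback S G xs) ys xh (feedback S G xh) (S.output x (feedback S G xh) w)
      simp only [sub_self, norm_zero, zero_add] at this
      -- Since `D = 0`, the output is the same under the held and the current input.
      refine this.trans (mul_le_mul_of_nonneg_left (add_le_add hkd (le_of_eq ?_)) hKo0)
      simp only [ay, output_eq hD]
    have h5 := (norm_stack_le (dx - S.field x (feedback S G xh) w)
          ((dx - S.field x (feedback S G xh) w)
            - (dh - observerField S G xh (feedback S G xh)
                (S.output x (feedback S G xh) w)))).trans (add_le_add_right (norm_sub_le _ _) _)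
    have h6 : 2 * pn * ‖z‖ * ‖stack (dx - S.field x (feedback S G xh) w)
          ((dx - S.field x (feedback S G xh) w)
            - (dh - observerField S G xh (feedback S G xh)
                (S.output x (feedback S G xh) w)))‖
        ≤ 2 * pn * ‖z‖ * (((2 * Kf + Ko) * Kk) * au + Ko * ay) := by
      refine mul_le_mul_of_nonneg_left ?_ (by positivity)
      linarith
    have h7 : 0 ≤ 2 * pn * ‖z‖ * (Ko * au + ((2 * Kf + Ko) * Kk) * ay)
        + (c₂ + c₃) * ‖z‖ * (au + ay) := by positivity
    have h8 : c₁ * ‖z‖ * (au + ay) = 2 * pn * ‖z‖ * (((2 * Kf + Ko) * Kk) * au + Ko * ay)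
        + 2 * pn * ‖z‖ * (Ko * au + ((2 * Kf + Ko) * Kk) * ay) := by rw [hc₁]; ring
    linarith
  · exact mul_le_mul_of_nonneg_right (by linarith) (by positivity)
  · exact mul_le_mul_of_nonneg_right (by linarith) (by positivity)

end Bounds

/-! ### The decrease of the Lyapunov function -/

/-- The core estimate: `v` bounds the state, `a`, `b` the errors of the mechanisms within their
dwell times, and `1 / τ` dominates the growth of the errors. -/
theorem quadratic_estimate {c α m q T σ v V a b ρ : ℝ} (hc : 1 ≤ c) (hα : 0 < α) (hm : 0 < m)
    (hσ0 : 0 ≤ σ) (hσ1 : σ ≤ 1) (hσ : 8 * c ^ 2 * σ ≤ α * m)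
    (hq : q = 3 * (144 * c ^ 4 / (α * m) + 11 * c ^ 2)) (hT : q + α / 2 ≤ T)
    (hv : 0 ≤ v) (ha : 0 ≤ a) (hb : 0 ≤ b) (hρ : 0 ≤ ρ) (hV : m * v ^ 2 ≤ V) :
    -α * V + c * ρ ^ 2 + c * v * (c * (a + σ * v + ρ) + c * (b + σ * v + ρ))
      + 2 * b * (c * (v + c * (a + σ * v + ρ) + ρ))
      + 2 * a * (c * (v + c * (a + σ * v + ρ) + c * (b + σ * v + ρ) + ρ))
      - T * (a ^ 2 + b ^ 2)
    ≤ -(α / 2) * (V + a ^ 2 + b ^ 2) + q * ρ ^ 2 := by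
  -- Every term is reduced to `v²`, `v s` and `s²`: the coefficients add up to `12 c²` for `v s` and
  -- `11 c²` for `s²`. The smallness of `σ` and Young's inequality each spend `α m / 4` of `v²`,
  -- together half of the decay of `V`.
  set s := a + b + ρ with hs
  have hs0 : 0 ≤ s := by positivity
  have hσv : σ * v ≤ v := mul_le_of_le_one_left hv hσ1
  have has : a ≤ s := by linarith
  have hbs : b ≤ s := by linarith
  have hρs : ρ ≤ s := by linarith
  have hcc : c ≤ c ^ 2 := by nlinarith
  have h1 : c * ρ ^ 2 ≤ c ^ 2 * s ^ 2 := by gcongr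
  have h2 : c * v * (c * (a + σ * v + ρ) + c * (b + σ * v + ρ))
      ≤ 2 * c ^ 2 * σ * v ^ 2 + 2 * c ^ 2 * (v * s) := by
    have : 0 ≤ c ^ 2 * v * (a + b) := by positivity
    rw [hs]; nlinarith
  have h3 : 2 * b * (c * (v + c * (a + σ * v + ρ) + ρ)) ≤ 4 * c ^ 2 * (v * s) + 4 * c ^ 2 * s ^ 2 := by
    have e1 : v + c * (a + σ * v + ρ) + ρ ≤ 2 * c * v + 2 * c * s := by
      have : c * (a + σ * v + ρ) ≤ c * (s + v) :=
        mul_le_mul_of_nonneg_left (by linarith) (by linarith)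
      nlinarith
    calc _ ≤ 2 * s * (c * (2 * c * v + 2 * c * s)) := by gcongr
      _ = _ := by ring
  have h4 : 2 * a * (c * (v + c * (a + σ * v + ρ) + c * (b + σ * v + ρ) + ρ))
      ≤ 6 * c ^ 2 * (v * s) + 6 * c ^ 2 * s ^ 2 := by
    have e1 : v + c * (a + σ * v + ρ) + c * (b + σ * v + ρ) + ρ ≤ 3 * c * v + 3 * c * s := by
      have : c * (a + σ * v + ρ) ≤ c * (s + v) :=
        mul_le_mul_of_nonneg_left (by linarith) (by linarith)
      have : c * (b + σ * v + ρ) ≤ c * (s + v) :=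
        mul_le_mul_of_nonneg_left (by linarith) (by linarith)
      nlinarith
    calc _ ≤ 2 * s * (c * (3 * c * v + 3 * c * s)) := by gcongr
      _ = _ := by ring
  have h5 : 2 * c ^ 2 * σ * v ^ 2 ≤ α * m / 4 * v ^ 2 := by gcongr; linarith
  have h6 : 12 * c ^ 2 * (v * s) ≤ α * m / 4 * v ^ 2 + 144 * c ^ 4 / (α * m) * s ^ 2 := by
    have hαm : 0 < α * m := by positivity
    have : α * m / 4 * v ^ 2 + 144 * c ^ 4 / (α * m) * s ^ 2 - 12 * c ^ 2 * (v * s)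
        = (α * m * v - 24 * c ^ 2 * s) ^ 2 / (4 * (α * m)) := by field_simp; ring
    have : 0 ≤ (α * m * v - 24 * c ^ 2 * s) ^ 2 / (4 * (α * m)) := by positivity
    linarith
  have h7 : s ^ 2 ≤ 3 * (a ^ 2 + b ^ 2 + ρ ^ 2) := by
    rw [hs]; nlinarith [sq_nonneg (a - b), sq_nonneg (a - ρ), sq_nonneg (b - ρ)]
  have h8 : (144 * c ^ 4 / (α * m) + 11 * c ^ 2) * s ^ 2 ≤ q * (a ^ 2 + b ^ 2 + ρ ^ 2) := by
    rw [hq]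
    calc _ ≤ (144 * c ^ 4 / (α * m) + 11 * c ^ 2) * (3 * (a ^ 2 + b ^ 2 + ρ ^ 2)) := by gcongr
      _ = _ := by ring
  have h9 : (q + α / 2) * (a ^ 2 + b ^ 2) ≤ T * (a ^ 2 + b ^ 2) := by gcongr
  have h10 : α * (m * v ^ 2) ≤ α * V := by gcongr
  linarith

/-- Decrease of `V + φ b² + ψ a²`, where `a`, `b` are the sampling errors of the two mechanisms,
whether or not the mechanisms are within their dwell times. -/
theorem lyapunov_decrease {c α m q τ σ v V a ay b ρ φ ψ φ' ψ' dV dx dh : ℝ}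
    (hc : 1 ≤ c) (hα : 0 < α) (hm : 0 < m)
    (hσ0 : 0 ≤ σ) (hσ1 : σ ≤ 1) (hσ : 8 * c ^ 2 * σ ≤ α * m)
    (hq : q = 3 * (144 * c ^ 4 / (α * m) + 11 * c ^ 2)) (hτ : q + α / 2 ≤ τ⁻¹)
    (hv : 0 ≤ v) (ha : 0 ≤ a) (hb : 0 ≤ b) (hρ : 0 ≤ ρ) (hV : m * v ^ 2 ≤ V)
    (hdx0 : 0 ≤ dx) (hdh0 : 0 ≤ dh)
    (hdV : dV ≤ -α * V + c * ρ ^ 2 + c * v * (a + ay))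
    (hdx : dx ≤ c * (v + a + ρ)) (hdh : dh ≤ c * (v + a + ay + ρ))
    (hφ : 0 ≤ φ ∧ φ ≤ 1) (hψ : 0 ≤ ψ ∧ ψ ≤ 1)
    (hy : φ' = -τ⁻¹ ∧ ay ≤ c * (b + ρ) ∨ φ = 0 ∧ φ' = 0 ∧ ay ≤ c * (σ * v + ρ))
    (hu : ψ' = -τ⁻¹ ∨ ψ = 0 ∧ ψ' = 0 ∧ a ≤ c * (σ * v + ρ)) :
    dV + (φ' * b ^ 2 + φ * (2 * b * dx)) + (ψ' * a ^ 2 + ψ * (2 * a * dh))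
      ≤ -(α / 2) * (V + φ * b ^ 2 + ψ * a ^ 2) + q * ρ ^ 2 := by
  -- Both phases are merged into one estimate: `B` is the error itself within the dwell time and 0
  -- afterwards, when the trigger bounds the error. `A` plays the same role for the input mechanism.
  obtain ⟨B, hB0, hay, hB1, hB2, hB3⟩ : ∃ B, 0 ≤ B ∧ ay ≤ c * (B + σ * v + ρ) ∧ φ * b ≤ B ∧
      φ * b ^ 2 ≤ B ^ 2 ∧ φ' * b ^ 2 = -τ⁻¹ * B ^ 2 := by
    rcases hy with ⟨h1, h2⟩ | ⟨h1, h2, h3⟩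
    · refine ⟨b, hb, h2.trans ?_, by nlinarith, by nlinarith [sq_nonneg b], by rw [h1]⟩
      gcongr; nlinarith
    · exact ⟨0, le_rfl, by simpa using h3, by simp [h1], by simp [h1], by simp [h2]⟩
  obtain ⟨A, hA0, haA, hA1, hA2, hA3⟩ : ∃ A, 0 ≤ A ∧ a ≤ c * (A + σ * v + ρ) ∧ ψ * a ≤ A ∧
      ψ * a ^ 2 ≤ A ^ 2 ∧ ψ' * a ^ 2 = -τ⁻¹ * A ^ 2 := by
    rcases hu with h1 | ⟨h1, h2, h3⟩
    · refine ⟨a, ha, ?_, by nlinarith, by nlinarith [sq_nonneg a], by rw [h1]⟩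
      have : 0 ≤ σ * v := by positivity
      nlinarith
    · exact ⟨0, le_rfl, by simpa using h3, by simp [h1], by simp [h1], by simp [h2]⟩
  have key := quadratic_estimate hc hα hm hσ0 hσ1 hσ hq hτ hv hA0 hB0 hρ hV
  have h1 : c * v * (a + ay) ≤ c * v * (c * (A + σ * v + ρ) + c * (B + σ * v + ρ)) := by gcongr
  have h2 : φ * (2 * b * dx) ≤ 2 * B * (c * (v + c * (A + σ * v + ρ) + ρ)) := by
    have : dx ≤ c * (v + c * (A + σ * v + ρ) + ρ) := hdx.trans (by gcongr)
    calc φ * (2 * b * dx) = 2 * (φ * b) * dx := by ring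
      _ ≤ _ := by gcongr
  have h3 : ψ * (2 * a * dh)
      ≤ 2 * A * (c * (v + c * (A + σ * v + ρ) + c * (B + σ * v + ρ) + ρ)) := by
    have : dh ≤ c * (v + c * (A + σ * v + ρ) + c * (B + σ * v + ρ) + ρ) :=
      hdh.trans (by gcongr)
    calc ψ * (2 * a * dh) = 2 * (ψ * a) * dh := by ring
      _ ≤ _ := by gcongr
  have h4 : α / 2 * (V + φ * b ^ 2 + ψ * a ^ 2) ≤ α / 2 * (V + A ^ 2 + B ^ 2) := by
    have : V + φ * b ^ 2 + ψ * a ^ 2 ≤ V + A ^ 2 + B ^ 2 := by linarith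
    gcongr
  rw [hA3, hB3]
  linarith

/-! ### The Lyapunov function of the event-triggered loop -/

/-- The weight of a sampling error of age `s`: it decreases linearly from `1` to `0` within the
dwell time `τ` and vanishes afterwards. -/
noncomputable def decay (τ s : ℝ) : ℝ := max 0 (1 - τ⁻¹ * s)

theorem decay_nonneg (τ s : ℝ) : 0 ≤ decay τ s := le_max_left _ _

theorem decay_le_one {τ s : ℝ} (hτ : 0 < τ) (hs : 0 ≤ s) : decay τ s ≤ 1 :=
  max_le zero_le_one (by have : 0 ≤ τ⁻¹ * s := by positivity
                         linarith)

theorem lipschitz_decay_sub (τ t₀ : ℝ) : LipschitzWith ‖τ⁻¹‖₊ fun t => decay τ (t - t₀) := by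
  refine LipschitzWith.const_max (LipschitzWith.of_dist_le_mul fun s t => le_of_eq ?_) 0
  rw [Real.dist_eq, Real.dist_eq, coe_nnnorm, Real.norm_eq_abs, ← abs_mul, ← abs_neg]
  congr 1
  ring

theorem hasDerivAt_decay_of_lt {τ t₀ t : ℝ} (hτ : 0 < τ) (ht : t < t₀ + τ) :
    HasDerivAt (fun t => decay τ (t - t₀)) (-τ⁻¹) t := by
  have h : HasDerivAt (fun t => 1 - τ⁻¹ * (t - t₀)) (-τ⁻¹) t := by
    simpa using (((hasDerivAt_id t).sub_const t₀).const_mul τ⁻¹).const_sub 1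
  refine h.congr_of_eventuallyEq ?_
  filter_upwards [Iio_mem_nhds ht] with s hs
  refine max_eq_right ?_
  rw [sub_nonneg, inv_mul_le_iff₀ hτ]
  linarith [mem_Iio.1 hs]

theorem decay_eq_zero {τ s : ℝ} (hτ : 0 < τ) (hs : τ ≤ s) : decay τ s = 0 := by
  refine max_eq_left ?_
  rw [sub_nonpos, ← div_eq_inv_mul, one_le_div hτ]
  exact hs

theorem hasDerivAt_decay_of_gt {τ t₀ t : ℝ} (hτ : 0 < τ) (ht : t₀ + τ < t) :
    HasDerivAt (fun t => decay τ (t - t₀)) 0 t := by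
  refine (hasDerivAt_const t (0 : ℝ)).congr_of_eventuallyEq ?_
  filter_upwards [Ioi_mem_nhds ht] with s hs
  exact decay_eq_zero hτ (by linarith [mem_Ioi.1 hs])

section Lyapunov
variable {nx nu ny nq np nw : ℕ}

/-- `V(z)` plus the weighted squares of the sampling errors, where the mechanisms have sampled the
plant state `xy` at time `ty` and the observer state `xu` at time `tu`. -/
noncomputable def hybridLyapunov (P : Matrix (Fin nx ⊕ Fin nx) (Fin nx ⊕ Fin nx) ℝ) (τ ty : ℝ)
    (xy : EuclideanSpace ℝ (Fin nx)) (tu : ℝ) (xu : EuclideanSpace ℝ (Fin nx)) (t : ℝ)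
    (z : State nx) : ℝ :=
  quadForm P z + decay τ (t - ty) * ‖xy - State.plant z‖ ^ 2
    + decay τ (t - tu) * ‖xu - State.observer z‖ ^ 2

theorem quadForm_le_hybridLyapunov (P : Matrix (Fin nx ⊕ Fin nx) (Fin nx ⊕ Fin nx) ℝ) (τ ty : ℝ)
    (xy : EuclideanSpace ℝ (Fin nx)) (tu : ℝ) (xu : EuclideanSpace ℝ (Fin nx)) (t : ℝ)
    (z : State nx) : quadForm P z ≤ hybridLyapunov P τ ty xy tu xu t z := by
  have h1 := mul_nonneg (decay_nonneg τ (t - ty)) (sq_nonneg ‖xy - State.plant z‖)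
  have h2 := mul_nonneg (decay_nonneg τ (t - tu)) (sq_nonneg ‖xu - State.observer z‖)
  rw [hybridLyapunov]
  linarith

/-- Constants for which the Lyapunov function decreases. -/
structure Constants (S : Plant nx nu ny nq np nw) (G : Gains nx nu ny nq np)
    (P : Matrix (Fin nx ⊕ Fin nx) (Fin nx ⊕ Fin nx) ℝ) (α₀ μ ω₀ c m q τ σ : ℝ) : Prop where
  loop : LoopBounds S G P α₀ μ ω₀ c
  two_le : 2 ≤ c
  mu_le : μ ≤ c
  C_le : ‖actCLM S.C‖ ≤ c
  Fw_le : 2 * ‖actCLM S.Fw‖ ≤ c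
  alpha_pos : 0 < α₀
  m_pos : 0 < m
  quad : ∀ z : State nx, m * ‖z‖ ^ 2 ≤ quadForm P z
  sigma_nonneg : 0 ≤ σ
  sigma_le_one : σ ≤ 1
  sigma_le : 8 * c ^ 2 * σ ≤ α₀ * m
  q_eq : q = 3 * (144 * c ^ 4 / (α₀ * m) + 11 * c ^ 2)
  tau_pos : 0 < τ
  tau_le : q + α₀ / 2 ≤ τ⁻¹

variable {S : Plant nx nu ny nq np nw} {G : Gains nx nu ny nq np}
  {P : Matrix (Fin nx ⊕ Fin nx) (Fin nx ⊕ Fin nx) ℝ} {α₀ μ ω₀ c m q τ σ : ℝ}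

/-- The factor `c / 2` leaves room for a difference of two disturbance values, which may reach `2
ω`. -/
theorem Constants.output_le (hC : Constants S G P α₀ μ ω₀ c m q τ σ)
    (x : EuclideanSpace ℝ (Fin nx)) (w : EuclideanSpace ℝ (Fin nw)) :
    ‖act S.C x + act S.Fw w‖ ≤ c * ‖x‖ + c / 2 * ‖w‖ := by
  have h1 := norm_add_le (act S.C x) (act S.Fw w)
  have h2 := (actCLM S.C).le_of_opNorm_le hC.C_le x
  have h3 := (actCLM S.Fw).le_of_opNorm_le (c := c / 2) (by linarith [hC.Fw_le]) w
  rw [actCLM_apply] at h2 h3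
  linarith

/-- Decrease of the Lyapunov function between two triggering times. -/
theorem Constants.hybridLyapunov_decrease (hC : Constants S G P α₀ μ ω₀ c m q τ σ) (hD : S.D = 0)
    {ω : ℝ} {w : ℝ → EuclideanSpace ℝ (Fin nw)} (hw : ∀ t, 0 ≤ t → ‖w t‖ ≤ ω) (hω : ω ≤ ω₀)
    {ys : EuclideanSpace ℝ (Fin ny)} {xu xy : EuclideanSpace ℝ (Fin nx)}
    {wy : EuclideanSpace ℝ (Fin nw)} (hwy : ‖wy‖ ≤ ω) (hys : ys = act S.C xy + act S.Fw wy)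
    {r T ty tu : ℝ} (hr : 0 ≤ r) (hrT : r ≤ T) (hty : ty ≤ r) (htu : tu ≤ r)
    {ζ : ℝ → State nx} (hζ : IsHeldFlow S G w ys xu r ζ)
    (hy : ∀ t ∈ Ioo r T, ty + τ ≤ t →
      ‖ys - outputAlong S G w xu ζ t‖ ≤ σ * ‖outputAlong S G w xu ζ t‖ + 1)
    (hu : ∀ t ∈ Ioo r T, tu + τ ≤ t →
      ‖xu - State.observer (ζ t)‖ ≤ σ * ‖State.observer (ζ t)‖ + 1) :
    (hybridLyapunov P τ ty xy tu xu T (ζ T) - q * (ω + 1) ^ 2 / (α₀ / 2))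
        * Real.exp (α₀ / 2 * T)
      ≤ (hybridLyapunov P τ ty xy tu xu r (ζ r) - q * (ω + 1) ^ 2 / (α₀ / 2))
        * Real.exp (α₀ / 2 * r) := by
  have hc2 := hC.two_le
  have hω0 : 0 ≤ ω := (norm_nonneg _).trans hwy
  have hwt : ∀ t ∈ Icc r T, ‖w t‖ ≤ ω := fun t ht => hw t (hr.trans ht.1)
  set x : ℝ → EuclideanSpace ℝ (Fin nx) := fun t => State.plant (ζ t) with hx
  set xh : ℝ → EuclideanSpace ℝ (Fin nx) := fun t => State.observer (ζ t) with hxh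
  have hζs : ∀ t, ζ t = stackCLM (x t, x t - xh t) := fun t => (stack_plant_observer (ζ t)).symm
  have hζc : ContinuousOn ζ (Icc r T) := by
    rw [funext hζs]
    have h1 := hζ.1.continuousOn T
    have h2 := hζ.2.continuousOn T
    exact stackCLM.continuous.comp_continuousOn (h1.prodMk (h1.sub h2))
  -- A bound on the state bounds the velocities, so the flow is Lipschitz on `[r, T]` and the
  -- Lyapunov function absolutely continuous along it.
  obtain ⟨R, hR⟩ := isCompact_Icc.exists_bound_of_continuousOn hζc
  have hau : ∀ t, ‖xu - xh t‖ ≤ ‖xu‖ + 2 * ‖ζ t‖ := fun t =>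
    (norm_sub_le _ _).trans (add_le_add_right (norm_observer_le _) _)
  have hout : ∀ t, outputAlong S G w xu ζ t = act S.C (x t) + act S.Fw (w t) :=
    fun t => output_eq hD _ _ _
  have hon : ∀ t ∈ Icc r T, ‖outputAlong S G w xu ζ t‖ ≤ c * ‖ζ t‖ + c * ω := by
    intro t ht
    rw [hout]
    refine (hC.output_le _ _).trans (add_le_add ?_ ?_)
    · exact mul_le_mul_of_nonneg_left (norm_plant_le _) (by linarith)
    · exact mul_le_mul (by linarith) (hwt t ht) (norm_nonneg _) (by linarith)
  obtain ⟨Lx, hLx⟩ : ∃ L, LipschitzOnWith L x (Icc r T) := by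
    refine ⟨⟨|c * (R + (‖xu‖ + 2 * R) + ω)|, abs_nonneg _⟩, hζ.1.lipschitzOnWith fun t ht => ?_⟩
    refine ((hC.loop (ζ t) xu ys (w t) ((hwt t ht).trans hω)).2.1.trans ?_).trans (le_abs_self _)
    have h1 := hau t
    have h2 := hR t ht
    have h3 := hwt t ht
    exact mul_le_mul_of_nonneg_left (by linarith) (by linarith)
  obtain ⟨Lh, hLh⟩ : ∃ L, LipschitzOnWith L xh (Icc r T) := by
    refine ⟨⟨|c * (R + (‖xu‖ + 2 * R) + (‖ys‖ + (c * R + c * ω)) + ω)|, abs_nonneg _⟩,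
      hζ.2.lipschitzOnWith fun t ht => ?_⟩
    refine ((hC.loop (ζ t) xu ys (w t) ((hwt t ht).trans hω)).2.2.trans ?_).trans (le_abs_self _)
    have h1 := hau t
    have h2 := hR t ht
    have h3 := hwt t ht
    have h4 := norm_sub_le ys (outputAlong S G w xu ζ t)
    have h5 := hon t ht
    have h6 := mul_le_mul_of_nonneg_left h2 (by linarith : (0 : ℝ) ≤ c)
    rw [outputAlong] at h4 h5
    exact mul_le_mul_of_nonneg_left (by linarith) (by linarith)
  obtain ⟨Lζ, hLζ⟩ : ∃ L, LipschitzOnWith L ζ (uIcc r T) := by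
    rw [uIcc_of_le hrT, funext hζs]
    exact ⟨_, stackCLM.lipschitz.comp_lipschitzOnWith (hLx.prodMk (hLx.sub hLh))⟩
  obtain ⟨Ly, hLey⟩ : ∃ L, LipschitzOnWith L (fun t => xy - x t) (uIcc r T) := by
    rw [uIcc_of_le hrT]
    exact ⟨_, (LipschitzWith.const xy).lipschitzOnWith.sub hLx⟩
  obtain ⟨Lu, hLeu⟩ : ∃ L, LipschitzOnWith L (fun t => xu - xh t) (uIcc r T) := by
    rw [uIcc_of_le hrT]
    exact ⟨_, (LipschitzWith.const xu).lipschitzOnWith.sub hLh⟩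
  have hacV : AbsolutelyContinuousOnInterval (fun t => quadForm P (ζ t)) r T := by
    simp only [quadForm_eq_inner]
    exact absolutelyContinuous_inner hLζ ((lipschitz_act P).comp_lipschitzOnWith hLζ)
  have hacd : ∀ t₀, AbsolutelyContinuousOnInterval (fun t => decay τ (t - t₀)) r T :=
    fun t₀ => (lipschitz_decay_sub τ t₀).lipschitzOnWith.absolutelyContinuousOnInterval
  have hac : AbsolutelyContinuousOnInterval
      (fun t => hybridLyapunov P τ ty xy tu xu t (ζ t)) r T :=
    (hacV.fun_add ((hacd ty).fun_mul (absolutelyContinuous_norm_sq hLey))).fun_add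
      ((hacd tu).fun_mul (absolutelyContinuous_norm_sq hLeu))
  refine comparison_of_ae_deriv_le hrT hac ?_
  -- The weights have a kink at the end of each dwell time; these two instants are discarded.
  have hne : ∀ t₀ : ℝ, ∀ᵐ t : ℝ, t ≠ t₀ := fun t₀ => by simp [ae_iff, measure_singleton]
  filter_upwards [hζ.1.ae_hasDerivAt hrT, hζ.2.ae_hasDerivAt hrT, hne (ty + τ), hne (tu + τ)]
    with t hdx hdh hty' htu' ht
  have htc := Ioo_subset_Icc_self ht
  replace hdx := hdx ht
  replace hdh := hdh ht
  obtain ⟨hb1, hb2, hb3⟩ := hC.loop (ζ t) xu ys (w t) ((hwt t htc).trans hω)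
  set dx := S.field (State.plant (ζ t)) (feedback S G xu) (w t) with hdx_def
  set dh := observerField S G (State.observer (ζ t)) (feedback S G xu) ys with hdh_def
  have hdζ : HasDerivAt ζ (stack dx (dx - dh)) t := by
    rw [funext hζs]
    exact stackCLM.hasFDerivAt.comp_hasDerivAt t (hdx.prodMk (hdx.sub hdh))
  have hdV := ((differentiable_quadForm P) (ζ t)).hasFDerivAt.comp_hasDerivAt t hdζ
  have hdey := (hdx.const_sub xy).norm_sq
  have hdeu := (hdh.const_sub xu).norm_sq
  have hψ1 : decay τ (t - tu) ≤ 1 := decay_le_one hC.tau_pos (by linarith [ht.1])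
  have hφ1 : decay τ (t - ty) ≤ 1 := decay_le_one hC.tau_pos (by linarith [ht.1])
  have hwn := hwt t htc
  obtain ⟨φ', hφ', hyc⟩ : ∃ φ', HasDerivAt (fun t => decay τ (t - ty)) φ' t ∧
      (φ' = -τ⁻¹ ∧ ‖ys - outputAlong S G w xu ζ t‖ ≤ c * (‖xy - x t‖ + (ω + 1)) ∨
        decay τ (t - ty) = 0 ∧ φ' = 0 ∧
          ‖ys - outputAlong S G w xu ζ t‖ ≤ c * (σ * ‖ζ t‖ + (ω + 1))) := by
    rcases lt_or_gt_of_ne hty' with h | h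
    · refine ⟨_, hasDerivAt_decay_of_lt hC.tau_pos h, Or.inl ⟨rfl, ?_⟩⟩
      have h1 : ys - outputAlong S G w xu ζ t = act S.C (xy - x t) + act S.Fw (wy - w t) := by
        rw [hys, hout]
        simp only [← actCLM_apply, map_sub]
        abel
      rw [h1]
      refine (hC.output_le _ _).trans ?_
      have h2 : ‖wy - w t‖ ≤ 2 * ω := (norm_sub_le _ _).trans (by linarith)
      have h3 : c / 2 * ‖wy - w t‖ ≤ c / 2 * (2 * ω) :=
        mul_le_mul_of_nonneg_left h2 (by linarith)
      linarith
    · refine ⟨_, hasDerivAt_decay_of_gt hC.tau_pos h,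
        Or.inr ⟨decay_eq_zero hC.tau_pos (by linarith), rfl, (hy t ht h.le).trans ?_⟩⟩
      have h1 := mul_le_mul_of_nonneg_left (hon t htc) hC.sigma_nonneg
      have h2 : σ * (c * ω) ≤ 1 * (c * ω) :=
        mul_le_mul_of_nonneg_right hC.sigma_le_one (by positivity)
      linarith
  obtain ⟨ψ', hψ', huc⟩ : ∃ ψ', HasDerivAt (fun t => decay τ (t - tu)) ψ' t ∧
      (ψ' = -τ⁻¹ ∨ decay τ (t - tu) = 0 ∧ ψ' = 0 ∧
          ‖xu - xh t‖ ≤ c * (σ * ‖ζ t‖ + (ω + 1))) := by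
    rcases lt_or_gt_of_ne htu' with h | h
    · exact ⟨_, hasDerivAt_decay_of_lt hC.tau_pos h, Or.inl rfl⟩
    · refine ⟨_, hasDerivAt_decay_of_gt hC.tau_pos h,
        Or.inr ⟨decay_eq_zero hC.tau_pos (by linarith), rfl, (hu t ht h.le).trans ?_⟩⟩
      have h1 := mul_le_mul_of_nonneg_left (norm_observer_le (ζ t)) hC.sigma_nonneg
      -- The observer state is bounded by `2 ‖z‖`, whence the requirement `2 ≤ c`.
      have h2 : 2 * (σ * ‖ζ t‖) ≤ c * (σ * ‖ζ t‖) :=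
        mul_le_mul_of_nonneg_right hc2 (mul_nonneg hC.sigma_nonneg (norm_nonneg _))
      have h3 : 0 ≤ c * ω := by positivity
      linarith
  refine ⟨_, (hdV.add (hφ'.mul hdey)).add (hψ'.mul hdeu), ?_⟩
  have hiy : 2 * inner ℝ (xy - x t) (-dx) ≤ 2 * ‖xy - x t‖ * ‖dx‖ := by
    have := real_inner_le_norm (xy - x t) (-dx)
    rw [norm_neg] at this
    linarith
  have hiu : 2 * inner ℝ (xu - xh t) (-dh) ≤ 2 * ‖xu - xh t‖ * ‖dh‖ := by
    have := real_inner_le_norm (xu - xh t) (-dh)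
    rw [norm_neg] at this
    linarith
  have h1 := mul_le_mul_of_nonneg_left hiy (decay_nonneg τ (t - ty))
  have h2 := mul_le_mul_of_nonneg_left hiu (decay_nonneg τ (t - tu))
  -- The choice `ρ = ω + 1` collects the disturbance and the absolute threshold 1.
  have key := lyapunov_decrease (τ := τ) (σ := σ) (v := ‖ζ t‖) (V := quadForm P (ζ t))
    (a := ‖xu - xh t‖) (ay := ‖ys - outputAlong S G w xu ζ t‖) (b := ‖xy - x t‖) (ρ := ω + 1)
    (φ := decay τ (t - ty)) (ψ := decay τ (t - tu)) (φ' := φ') (ψ' := ψ')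
    (dV := fderiv ℝ (quadForm P) (ζ t) (stack dx (dx - dh))) (dx := ‖dx‖) (dh := ‖dh‖)
    (by linarith) hC.alpha_pos hC.m_pos hC.sigma_nonneg hC.sigma_le_one hC.sigma_le hC.q_eq
    hC.tau_le (norm_nonneg _) (norm_nonneg _) (norm_nonneg _) (by linarith) (hC.quad _)
    (norm_nonneg _) (norm_nonneg _)
    (hb1.trans (by
      have : μ * ‖w t‖ ^ 2 ≤ c * (ω + 1) ^ 2 := by
        have := hC.mu_le
        gcongr
        linarith
      exact add_le_add_left (add_le_add_right this _) _))
    (hb2.trans (mul_le_mul_of_nonneg_left (add_le_add_right (by linarith) _) (by linarith)))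
    (hb3.trans (mul_le_mul_of_nonneg_left (add_le_add_right (by linarith) _) (by linarith)))
    ⟨decay_nonneg _ _, hφ1⟩ ⟨decay_nonneg _ _, hψ1⟩ hyc huc
  have hκ : α₀ / 2 * (q * (ω + 1) ^ 2 / (α₀ / 2)) = q * (ω + 1) ^ 2 := by
    have := hC.alpha_pos
    field_simp
  simp only [hybridLyapunov]
  linarith

end Lyapunov

/-! ### Triggering times -/

section Next
variable {V : Type*} [NormedAddCommGroup V] (m : Trigger) (r : ℝ) (h : Sample V) (v : ℝ → V)

theorem Trigger.le_next : (r : EReal) ≤ m.next r h v := by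
  refine le_sInf ?_
  rintro _ ⟨t, ht, rfl⟩
  exact EReal.coe_le_coe_iff.2 ht.1

theorem Trigger.dwell_le_next : ((h.time + m.τ : ℝ) : EReal) ≤ m.next r h v := by
  refine le_sInf ?_
  rintro _ ⟨t, ht, rfl⟩
  exact EReal.coe_le_coe_iff.2 ht.2.1

variable {m r h v}

theorem Trigger.norm_sub_le_of_lt_next {t : ℝ} (hr : r ≤ t) (hτ : h.time + m.τ ≤ t)
    (ht : (t : EReal) < m.next r h v) : ‖h.value - v t‖ ≤ m.σ * ‖v t‖ + m.ε := by
  by_contra hlt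
  have hle : m.next r h v ≤ t := sInf_le (mem_image_of_mem _ ⟨hr, hτ, not_le.1 hlt⟩)
  exact absurd hle (not_le.2 ht)

end Next

/-! ### Decay along event-triggered trajectories and exclusion of accumulating triggerings. -/

section Estimate
variable {nx nu ny nq np nw : ℕ} {S : Plant nx nu ny nq np nw} {G : Gains nx nu ny nq np}
  {P : Matrix (Fin nx ⊕ Fin nx) (Fin nx ⊕ Fin nx) ℝ} {α₀ μ ω₀ c m q τ σ : ℝ}

/-- The state of the event-triggered loop after the `n`-th triggering, at time `r`: the samples held
are at most `r` old, the sampling times have advanced by at least `n τ` in total, and the Lyapunov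
function satisfies the decay estimate with initial value `V₀`. -/
structure TriggerInvariant (S : Plant nx nu ny nq np nw)
    (P : Matrix (Fin nx ⊕ Fin nx) (Fin nx ⊕ Fin nx) ℝ) (α τ κ ω V₀ : ℝ) (n : ℕ) (r : ℝ)
    (hy : Sample (EuclideanSpace ℝ (Fin ny))) (hu : Sample (EuclideanSpace ℝ (Fin nx)))
    (z : State nx) : Prop where
  nonneg : 0 ≤ r
  time_y : hy.time ≤ r
  time_u : hu.time ≤ r
  progress : n * τ ≤ hy.time + hu.time
  sampled : ∃ (xy : EuclideanSpace ℝ (Fin nx)) (wy : EuclideanSpace ℝ (Fin nw)), ‖wy‖ ≤ ω ∧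
    hy.value = act S.C xy + act S.Fw wy ∧
    (hybridLyapunov P τ hy.time xy hu.time hu.value r z - κ) * Real.exp (α * r) ≤ V₀

/-- Propagation of the decay estimate up to the next triggering time. -/
theorem Constants.invariant_flow (hC : Constants S G P α₀ μ ω₀ c m q τ σ) (hD : S.D = 0)
    {ω : ℝ} {w : ℝ → EuclideanSpace ℝ (Fin nw)} (hw : ∀ t, 0 ≤ t → ‖w t‖ ≤ ω) (hω : ω ≤ ω₀)
    {n : ℕ} {r T V₀ : ℝ} {hy : Sample (EuclideanSpace ℝ (Fin ny))}
    {hu : Sample (EuclideanSpace ℝ (Fin nx))} {ζ : ℝ → State nx}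
    (hI : TriggerInvariant (nw := nw) S P (α₀ / 2) τ (q * (ω + 1) ^ 2 / (α₀ / 2)) ω V₀ n r hy hu
      (ζ r))
    (hζ : IsHeldFlow S G w hy.value hu.value r ζ) (hrT : r ≤ T)
    (hT : (T : EReal) ≤ min
      (Trigger.next ⟨τ, σ, 1⟩ r hy (outputAlong S G w hu.value ζ))
      (Trigger.next ⟨τ, σ, 1⟩ r hu fun t => State.observer (ζ t))) :
    ∃ (xy : EuclideanSpace ℝ (Fin nx)) (wy : EuclideanSpace ℝ (Fin nw)), ‖wy‖ ≤ ω ∧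
      hy.value = act S.C xy + act S.Fw wy ∧
      (hybridLyapunov P τ hy.time xy hu.time hu.value T (ζ T) - q * (ω + 1) ^ 2 / (α₀ / 2))
        * Real.exp (α₀ / 2 * T) ≤ V₀ := by
  obtain ⟨xy, wy, hwy, hys, hle⟩ := hI.sampled
  refine ⟨xy, wy, hwy, hys, (hC.hybridLyapunov_decrease hD hw hω hwy hys hI.nonneg hrT hI.time_y
    hI.time_u hζ ?_ ?_).trans hle⟩
  · intro t ht hτ
    have h1 : (t : EReal) < T := EReal.coe_lt_coe_iff.2 ht.2
    exact Trigger.norm_sub_le_of_lt_next (m := ⟨τ, σ, 1⟩) ht.1.le hτ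
      (h1.trans_le (hT.trans (min_le_left _ _)))
  · intro t ht hτ
    have h1 : (t : EReal) < T := EReal.coe_lt_coe_iff.2 ht.2
    exact Trigger.norm_sub_le_of_lt_next (m := ⟨τ, σ, 1⟩)
      (v := fun t => State.observer (ζ t)) ht.1.le hτ (h1.trans_le (hT.trans (min_le_right _ _)))

/-- The invariant survives a triggering of one or both mechanisms. -/
theorem Constants.invariant_jump (hC : Constants S G P α₀ μ ω₀ c m q τ σ) (hD : S.D = 0)
    {ω : ℝ} {w : ℝ → EuclideanSpace ℝ (Fin nw)} (hw : ∀ t, 0 ≤ t → ‖w t‖ ≤ ω) (hω : ω ≤ ω₀)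
    {n : ℕ} {r r' V₀ : ℝ} {hy : Sample (EuclideanSpace ℝ (Fin ny))}
    {hu : Sample (EuclideanSpace ℝ (Fin nx))} {ζ : ℝ → State nx} {nextY nextU : EReal}
    (hI : TriggerInvariant (nw := nw) S P (α₀ / 2) τ (q * (ω + 1) ^ 2 / (α₀ / 2)) ω V₀ n r hy hu
      (ζ r))
    (hζ : IsHeldFlow S G w hy.value hu.value r ζ)
    (hY : nextY = Trigger.next ⟨τ, σ, 1⟩ r hy (outputAlong S G w hu.value ζ))
    (hU : nextU = Trigger.next ⟨τ, σ, 1⟩ r hu fun t => State.observer (ζ t))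
    (hr' : (r' : EReal) = min nextY nextU) :
    TriggerInvariant (nw := nw) S P (α₀ / 2) τ (q * (ω + 1) ^ 2 / (α₀ / 2)) ω V₀ (n + 1) r'
      (if nextY ≤ nextU then ⟨r', outputAlong S G w hu.value ζ r'⟩ else hy)
      (if nextU ≤ nextY then ⟨r', State.observer (ζ r')⟩ else hu) (ζ r') := by
  have hrr : r ≤ r' := by
    rw [← EReal.coe_le_coe_iff, hr', hY, hU]
    exact le_min (Trigger.le_next _ _ _ _) (Trigger.le_next _ _ _ _)
  have hr0 : 0 ≤ r' := hI.nonneg.trans hrr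
  have hτ := hC.tau_pos
  obtain ⟨xy, wy, hwy, hys, hle⟩ := hC.invariant_flow hD hw hω hI hζ hrr
    (by rw [hr', hY, hU])
  have hty := hI.time_y
  have htu := hI.time_u
  have hdy : nextY ≤ nextU → hy.time + τ ≤ r' := by
    intro h
    rw [min_eq_left h] at hr'
    rw [← EReal.coe_le_coe_iff, hr', hY]
    exact Trigger.dwell_le_next ⟨τ, σ, 1⟩ r hy _
  have hdu : nextU ≤ nextY → hu.time + τ ≤ r' := by
    intro h
    rw [min_eq_right h] at hr'
    rw [← EReal.coe_le_coe_iff, hr', hU]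
    exact Trigger.dwell_le_next ⟨τ, σ, 1⟩ r hu _
  have hp := hI.progress
  refine ⟨hr0, ?_, ?_, ?_, ?_⟩
  · split_ifs
    exacts [le_rfl, by linarith]
  · split_ifs
    exacts [le_rfl, by linarith]
  -- At least one mechanism samples, and its sampling time advances by at least `τ`.
  · push_cast
    split_ifs with h1 h2 h2
    · linarith [hdy h1]
    · linarith [hdy h1]
    · linarith [hdu h2]
    · exact absurd (le_total nextY nextU) (by tauto)
  · refine ⟨if nextY ≤ nextU then State.plant (ζ r') else xy, if nextY ≤ nextU then w r' else wy,
      ?_, ?_, le_trans ?_ hle⟩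
    · split_ifs
      exacts [hw _ hr0, hwy]
    · split_ifs
      exacts [output_eq hD _ _ _, hys]
    · refine mul_le_mul_of_nonneg_right (sub_le_sub_right ?_ _) (Real.exp_pos _).le
      have h1 := mul_nonneg (decay_nonneg τ (r' - hy.time)) (sq_nonneg ‖xy - State.plant (ζ r')‖)
      have h2 := mul_nonneg (decay_nonneg τ (r' - hu.time))
        (sq_nonneg ‖hu.value - State.observer (ζ r')‖)
      simp only [hybridLyapunov]
      -- A fresh sample has error zero, so its term drops out; the other terms are unchanged.
      refine add_le_add (add_le_add le_rfl ?_) ?_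
      · split_ifs
        · simpa using h1
        · exact le_rfl
      · split_ifs
        · simpa using h2
        · exact le_rfl

/-- Decay of `V` along every trajectory of the event-triggered loop. -/
theorem Constants.quadForm_le_of_trajectory (hC : Constants S G P α₀ μ ω₀ c m q τ σ)
    (hD : S.D = 0) {ω : ℝ} {w : ℝ → EuclideanSpace ℝ (Fin nw)} (hw : ∀ t, 0 ≤ t → ‖w t‖ ≤ ω)
    (hω : ω ≤ ω₀) {z : ℝ → State nx}
    (hz : IsETTrajectory S G ⟨τ, σ, 1⟩ ⟨τ, σ, 1⟩ w z) {t : ℝ} (ht : 0 ≤ t) :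
    (quadForm P (z t) - q * (ω + 1) ^ 2 / (α₀ / 2)) * Real.exp (α₀ / 2 * t)
      ≤ quadForm P (z 0) := by
  obtain ⟨s, hy, hu, ζ, hs0, hu0, hy0, hstep⟩ := hz
  set κ := q * (ω + 1) ^ 2 / (α₀ / 2) with hκ
  have hq0 : 0 ≤ q := by
    have := hC.alpha_pos
    have := hC.m_pos
    rw [hC.q_eq]
    positivity
  have hκ0 : 0 ≤ κ := by
    have := hC.alpha_pos
    positivity
  -- If the estimate fails at `t`, no flow interval may reach `t`, since `invariant_flow` would
  -- prove it there. So infinitely many triggerings precede `t`, against `n τ ≤ 2 t`.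
  by_contra hcon
  have hprog : ∀ n : ℕ, ∃ r : ℝ, s n = r ∧ r ≤ t ∧
      TriggerInvariant (nw := nw) S P (α₀ / 2) τ κ ω (quadForm P (z 0)) n r (hy n) (hu n)
        (ζ n r) := by
    intro n
    induction n with
    | zero =>
      have hz0 : z 0 = ζ 0 0 := by
        obtain ⟨-, h2, h3, -⟩ := hstep 0 0 (by rw [hs0]; rfl)
        refine h3 0 le_rfl ?_
        rw [h2]
        exact le_min (Trigger.le_next _ _ _ _) (Trigger.le_next _ _ _ _)
      refine ⟨0, by rw [hs0]; rfl, ht, le_rfl, by rw [hy0], by rw [hu0], by rw [hy0, hu0]; simp,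
        State.plant (z 0), w 0, hw 0 le_rfl, ?_, ?_⟩
      · rw [hy0]
        exact output_eq hD _ _ _
      · rw [hy0, hu0, ← hz0]
        simp only [hybridLyapunov]
        simpa using hκ0
    | succ n ih =>
      obtain ⟨r, hr, hrt, hI⟩ := ih
      obtain ⟨h1, h2, h3, h4⟩ := hstep n r hr
      have hlt : s (n + 1) < t := by
        by_contra hle
        rw [not_lt] at hle
        obtain ⟨xy, wy, -, -, hb⟩ := hC.invariant_flow hD hw hω hI h1 hrt (h2 ▸ hle)
        refine hcon (le_trans ?_ hb)
        rw [h3 t hrt hle]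
        exact mul_le_mul_of_nonneg_right
          (sub_le_sub_right (quadForm_le_hybridLyapunov _ _ _ _ _ _ _ _) _) (Real.exp_pos _).le
      have hge : (r : EReal) ≤ s (n + 1) := by
        rw [h2]
        exact le_min (Trigger.le_next _ _ _ _) (Trigger.le_next _ _ _ _)
      obtain ⟨r', hr'⟩ : ∃ r' : ℝ, s (n + 1) = r' :=
        ⟨(s (n + 1)).toReal, (EReal.coe_toReal (ne_top_of_lt hlt)
          (ne_bot_of_gt ((EReal.bot_lt_coe r).trans_le hge))).symm⟩
      have hrr : r ≤ r' := by
        rw [← EReal.coe_le_coe_iff, ← hr']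
        exact hge
      refine ⟨r', hr', (EReal.coe_lt_coe_iff.1 (hr' ▸ hlt)).le, ?_⟩
      -- Both flows agree with the trajectory at the common endpoint, which is how continuity of `z`
      -- enters.
      have hzz : ζ (n + 1) r' = ζ n r' := by
        obtain ⟨-, h6, h7, -⟩ := hstep (n + 1) r' hr'
        rw [← h3 r' hrr hr'.ge, ← h7 r' le_rfl]
        rw [h6]
        exact le_min (Trigger.le_next _ _ _ _) (Trigger.le_next _ _ _ _)
      rw [(h4 r' hr').1, (h4 r' hr').2, hzz]
      exact hC.invariant_jump hD hw hω hI h1 rfl rfl (hr' ▸ h2)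
  obtain ⟨n, hn⟩ := exists_nat_gt (2 * t / τ)
  obtain ⟨r, -, hrt, hI⟩ := hprog n
  have h1 := hI.progress
  have h2 := hI.time_y
  have h3 := hI.time_u
  rw [div_lt_iff₀ hC.tau_pos] at hn
  linarith

end Estimate

/-! ### Existence of trajectories -/

section Existence
variable {nx nu ny nq np nw : ℕ} {S : Plant nx nu ny nq np nw} (G : Gains nx nu ny nq np)

/-- Held samples decouple plant and observer: the first is driven by `E_w w`, the second is
autonomous. -/
theorem exists_isHeldFlow (hp : ∃ ℓ : ℝ≥0, LipschitzWith ℓ S.p)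
    {w : ℝ → EuclideanSpace ℝ (Fin nw)} {ω : ℝ} (hwm : Measurable w)
    (hw : ∀ t, 0 ≤ t → ‖w t‖ ≤ ω) (ys : EuclideanSpace ℝ (Fin ny))
    (xs : EuclideanSpace ℝ (Fin nx)) {r : ℝ} (hr : 0 ≤ r) (z₀ : State nx) :
    ∃ ζ : ℝ → State nx, ζ r = z₀ ∧ IsHeldFlow S G w ys xs r ζ := by
  obtain ⟨Kf, hKf⟩ := exists_lipschitz_field hp
  obtain ⟨Ko, hKo⟩ := exists_lipschitz_observerField G hp
  have hf : LipschitzWith Kf fun x => S.field x (feedback S G xs) 0 :=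
    LipschitzWith.of_dist_le_mul fun x x' => by
      simpa [Prod.dist_eq] using
        hKf.dist_le_mul (x, feedback S G xs, 0) (x', feedback S G xs, 0)
  have ho : LipschitzWith Ko fun x => observerField S G x (feedback S G xs) ys :=
    LipschitzWith.of_dist_le_mul fun x x' => by
      simpa [Prod.dist_eq] using
        hKo.dist_le_mul (x, feedback S G xs, ys) (x', feedback S G xs, ys)
  have hg : AEStronglyMeasurable (fun t => act S.Ew (w t)) volume :=
    ((lipschitz_act S.Ew).continuous.measurable.comp hwm).aestronglyMeasurable
  have hgc : ∀ t, r ≤ t → ‖act S.Ew (w t)‖ ≤ ‖actCLM S.Ew‖ * ω :=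
    fun t ht => (actCLM S.Ew).le_opNorm_of_le (hw t (hr.trans ht))
  obtain ⟨x, hx0, hx⟩ := exists_isSolutionFrom hf hg hgc (State.plant z₀)
  obtain ⟨xh, hxh0, hxh⟩ := exists_isSolutionFrom ho
    (g := fun _ => 0) aestronglyMeasurable_const (c := 0) (r := r) (fun t _ => by simp)
    (State.observer z₀)
  refine ⟨fun t => stack (x t) (x t - xh t), ?_, ?_, ?_⟩
  · simp only [hx0, hxh0]
    exact stack_plant_observer z₀
  · simp only [plant_stack]
    simpa only [← field_add] using hx
  · simp only [observer_stack]
    simpa only [add_zero] using hxh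

/-- The time of a triggering, the samples held from then on, and the state at that time. -/
structure Stage (nx ny : ℕ) where
  time : EReal
  heldY : Sample (EuclideanSpace ℝ (Fin ny))
  heldU : Sample (EuclideanSpace ℝ (Fin nx))
  state : State nx

/-- The stage after `a`, when the flow from `a` is `ζ`. -/
noncomputable def Stage.succ (S : Plant nx nu ny nq np nw) (my mu : Trigger)
    (w : ℝ → EuclideanSpace ℝ (Fin nw)) (a : Stage nx ny) (ζ : ℝ → State nx) : Stage nx ny :=
  let y := outputAlong S G w a.heldU.value ζ
  let xh := fun t => State.observer (ζ t)
  let nextY := my.next a.time.toReal a.heldY y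
  let nextU := mu.next a.time.toReal a.heldU xh
  let r' := (min nextY nextU).toReal
  open Classical in
  -- Without the case distinction, `toReal ⊤ = 0` would restart the loop at time 0.
  { time := if a.time = ⊤ then ⊤ else min nextY nextU
    heldY := if nextY ≤ nextU then ⟨r', y r'⟩ else a.heldY
    heldU := if nextU ≤ nextY then ⟨r', xh r'⟩ else a.heldU
    state := ζ r' }

variable {G}

theorem exists_isETTrajectory (hp : ∃ ℓ : ℝ≥0, LipschitzWith ℓ S.p) (my mu : Trigger)
    {w : ℝ → EuclideanSpace ℝ (Fin nw)} {ω : ℝ} (hwm : Measurable w)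
    (hw : ∀ t, 0 ≤ t → ‖w t‖ ≤ ω) (z₀ : State nx) :
    ∃ z : ℝ → State nx, z 0 = z₀ ∧ IsETTrajectory S G my mu w z := by
  classical
  have hex : ∀ a : Stage nx ny, ∃ ζ : ℝ → State nx, 0 ≤ a.time.toReal →
      ζ a.time.toReal = a.state ∧
        IsHeldFlow S G w a.heldY.value a.heldU.value a.time.toReal ζ := by
    intro a
    by_cases ha : 0 ≤ a.time.toReal
    · obtain ⟨ζ, hζ⟩ := exists_isHeldFlow G hp hwm hw a.heldY.value a.heldU.value ha a.state
      exact ⟨ζ, fun _ => hζ⟩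
    · exact ⟨fun _ => 0, fun h => absurd h ha⟩
  choose flow hflow using hex
  let a₀ : Stage nx ny := ⟨0, ⟨0, S.output (State.plant z₀)
    (feedback S G (State.observer z₀)) (w 0)⟩, ⟨0, State.observer z₀⟩, z₀⟩
  let a : ℕ → Stage nx ny := fun n => Nat.rec a₀ (fun _ b => b.succ G S my mu w (flow b)) n
  have ha_succ : ∀ n, a (n + 1) = (a n).succ G S my mu w (flow (a n)) := fun _ => rfl
  set s : ℕ → EReal := fun n => (a n).time with hs
  set ζ : ℕ → ℝ → State nx := fun n => flow (a n) with hζ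
  have hs0 : s 0 = 0 := rfl
  have hmono1 : ∀ n, 0 ≤ s n → s n ≤ s (n + 1) := by
    intro n hn
    simp only [hs, ha_succ, Stage.succ]
    split_ifs with h
    · exact le_top
    · have h1 : (((a n).time.toReal : ℝ) : EReal) = (a n).time :=
        EReal.coe_toReal h (ne_bot_of_le_ne_bot (by simp) hn)
      calc (a n).time = (((a n).time.toReal : ℝ) : EReal) := h1.symm
        _ ≤ _ := le_min (Trigger.le_next _ _ _ _) (Trigger.le_next _ _ _ _)
  have hnn : ∀ n, 0 ≤ s n := by
    intro n
    induction n with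
    | zero => exact hs0.ge
    | succ n ih => exact ih.trans (hmono1 n ih)
  have hmono : Monotone s := monotone_nat_of_le_succ fun n => hmono1 n (hnn n)
  have htr : ∀ n, 0 ≤ (a n).time.toReal := fun n => EReal.toReal_nonneg (hnn n)
  have hglue : ∀ n (t : ℝ), s (n + 1) = t → ζ (n + 1) t = ζ n t := by
    intro n t ht
    have hne : (a n).time ≠ ⊤ := by
      intro h
      have : s (n + 1) = ⊤ := by simp only [hs, ha_succ, Stage.succ, h, if_true]
      rw [this] at ht
      exact absurd ht.symm (EReal.coe_ne_top t)
    have h1 := (hflow (a (n + 1)) (htr (n + 1))).1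
    have h2 : (a (n + 1)).time.toReal = t := by
      rw [show (a (n + 1)).time = t from ht, EReal.toReal_coe]
    rw [h2] at h1
    rw [hζ]
    simp only
    rw [h1]
    have h3 : (a (n + 1)).state = flow (a n) (a (n + 1)).time.toReal := by
      simp only [ha_succ, Stage.succ, if_neg hne]
    rw [h3, h2]
  let z : ℝ → State nx := fun t =>
    if h : ∃ n, (t : EReal) ≤ s (n + 1) then ζ (Nat.find h) t else 0
  have hz : ∀ n (t : ℝ), s n ≤ t → (t : EReal) ≤ s (n + 1) → z t = ζ n t := by
    intro n t h1 h2
    have h : ∃ n, (t : EReal) ≤ s (n + 1) := ⟨n, h2⟩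
    simp only [z, dif_pos h]
    have hle : Nat.find h ≤ n := Nat.find_min' h h2
    -- If `t` lies in several flow intervals, it is the triggering time at which they meet, and
    -- `hglue` applies.
    have hconst : ∀ k, Nat.find h ≤ k → k ≤ n → ζ k t = ζ (Nat.find h) t := by
      intro k hk
      induction k, hk using Nat.le_induction with
      | base => exact fun _ => rfl
      | succ k hk ih =>
        intro hkn
        rw [← ih (by omega)]
        refine hglue k t (le_antisymm ((hmono hkn).trans h1) ?_)
        have hspec : (t : EReal) ≤ s (Nat.find h + 1) := Nat.find_spec h
        exact hspec.trans (hmono (Nat.succ_le_succ hk))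
    exact (hconst n hle le_rfl).symm
  have hz0 : z 0 = z₀ := by
    have h1 := hz 0 0 (by rw [hs0]; rfl) (by simpa using hnn 1)
    have h2 := (hflow (a 0) (htr 0)).1
    have h3 : (a 0).time.toReal = 0 := EReal.toReal_zero
    rw [h3] at h2
    exact h1.trans h2
  refine ⟨z, hz0, s, fun n => (a n).heldY, fun n => (a n).heldU, ζ, hs0, ?_, ?_, ?_⟩
  · rw [hz0]
    rfl
  · simp only [outputAlong, hz0]
    rfl
  · intro n r hr
    have htn : (a n).time.toReal = r := by
      rw [show (a n).time = r from hr, EReal.toReal_coe]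
    have hne : (a n).time ≠ ⊤ := by
      rw [show (a n).time = r from hr]
      exact EReal.coe_ne_top r
    refine ⟨htn ▸ (hflow (a n) (htr n)).2, ?_, fun t ht ht' => hz n t ?_ ht', ?_⟩
    · simp only [hs, ha_succ, Stage.succ, if_neg hne, htn, hζ]
    · rw [hr]
      exact EReal.coe_le_coe_iff.2 ht
    · intro r' hr'
      simp only [hs, ha_succ, Stage.succ, if_neg hne, htn] at hr'
      simp only [ha_succ, Stage.succ, htn, hζ, hr', EReal.toReal_coe]
      exact ⟨trivial, trivial⟩

end Existence

/-! ### Input-to-state practical stability -/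

/-- Admissibility bounds the range; an unbounded supremum would default to 0. -/
theorem norm_le_supNorm {W : Type*} [NormedAddCommGroup W] [MeasurableSpace W] {ω₀ : ℝ}
    {w : ℝ → W} (hw : Admissible ω₀ w) {t : ℝ} (ht : 0 ≤ t) : ‖w t‖ ≤ supNorm w := by
  have hb : BddAbove (range fun t : ℝ≥0 => ‖w t‖₊) := by
    refine ⟨ω₀.toNNReal, ?_⟩
    rintro _ ⟨t, rfl⟩
    rw [← NNReal.coe_le_coe, coe_nnnorm]
    exact (hw.2 t t.2).trans (Real.le_coe_toNNReal _)
  have := le_ciSup hb (⟨t, ht⟩ : ℝ≥0)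
  exact NNReal.coe_le_coe.2 this

theorem supNorm_le {W : Type*} [NormedAddCommGroup W] [MeasurableSpace W] {ω₀ : ℝ}
    {w : ℝ → W} (hw : Admissible ω₀ w) : (supNorm w : ℝ) ≤ ω₀ := by
  have h0 : 0 ≤ ω₀ := (norm_nonneg _).trans (hw.2 0 le_rfl)
  rw [← Real.coe_toNNReal ω₀ h0, NNReal.coe_le_coe]
  refine ciSup_le fun t => ?_
  rw [← NNReal.coe_le_coe, coe_nnnorm, Real.coe_toNNReal ω₀ h0]
  exact hw.2 t t.2

theorem classK_const_mul {a : ℝ≥0} (ha : 0 < a) : ClassK fun r => a * r :=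
  ⟨by fun_prop, fun _ _ h => mul_lt_mul_of_pos_left h ha, mul_zero a⟩

theorem classKL_exp {a lam : ℝ≥0} (ha : 0 < a) (hlam : 0 < lam) :
    ClassKL fun r s => a * r * (Real.exp (-(lam * s))).toNNReal := by
  have hexp : Continuous fun s : ℝ≥0 => (Real.exp (-(lam * s))).toNNReal :=
    continuous_real_toNNReal.comp (by fun_prop)
  refine ⟨?_, fun s => ?_, fun r => ⟨fun s t hst => ?_, ?_⟩⟩
  · exact (continuous_const.mul continuous_fst).mul (hexp.comp continuous_snd)
  · have hb : 0 < a * (Real.exp (-(lam * s))).toNNReal :=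
      mul_pos ha (Real.toNNReal_pos.2 (Real.exp_pos _))
    have heq : (fun r : ℝ≥0 => a * r * (Real.exp (-(lam * s))).toNNReal)
        = fun r => a * (Real.exp (-(lam * s))).toNNReal * r := funext fun r => mul_right_comm _ _ _
    rw [heq]
    refine ⟨classK_const_mul hb, NNReal.tendsto_coe_atTop.1 ?_⟩
    simp only [NNReal.coe_mul]
    exact (NNReal.tendsto_coe_atTop.2 tendsto_id).const_mul_atTop (NNReal.coe_pos.2 hb)
  · refine mul_le_mul_right (Real.toNNReal_le_toNNReal (Real.exp_le_exp.2 (neg_le_neg ?_))) _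
    exact mul_le_mul_of_nonneg_left (NNReal.coe_le_coe.2 hst) lam.2
  · have h : Tendsto (fun s : ℝ≥0 => Real.exp (-(lam * s))) atTop (𝓝 0) :=
      Real.tendsto_exp_neg_atTop_nhds_zero.comp
        ((NNReal.tendsto_coe_atTop.2 tendsto_id).const_mul_atTop (NNReal.coe_pos.2 hlam))
    simpa using (tendsto_real_toNNReal h).const_mul (a * r)

section Stability
variable {nx nu ny nq np nw : ℕ} {S : Plant nx nu ny nq np nw} {G : Gains nx nu ny nq np}
  {P : Matrix (Fin nx ⊕ Fin nx) (Fin nx ⊕ Fin nx) ℝ} {α₀ μ ω₀ c m q τ σ : ℝ}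

/-- The square root of the decay of `V` halves the rate to `α₀ / 4` and splits the offset into a
gain times `ω` and a constant. Adding 1 to the gains keeps them positive, as the comparison classes
require. -/
theorem Constants.norm_le_of_trajectory (hC : Constants S G P α₀ μ ω₀ c m q τ σ)
    (hD : S.D = 0) {ω : ℝ} {w : ℝ → EuclideanSpace ℝ (Fin nw)} (hw : ∀ t, 0 ≤ t → ‖w t‖ ≤ ω)
    (hω : ω ≤ ω₀) {z : ℝ → State nx}
    (hz : IsETTrajectory S G ⟨τ, σ, 1⟩ ⟨τ, σ, 1⟩ w z) {t : ℝ} (ht : 0 ≤ t) :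
    ‖z t‖ ≤ (√(‖actCLM P‖ / m) + 1) * ‖z 0‖ * Real.exp (-(α₀ / 4 * t))
      + (√(q / (α₀ / 2) / m) + 1) * ω + (√(q / (α₀ / 2) / m) + 1) := by
  have h := hC.quadForm_le_of_trajectory hD hw hω hz ht
  have hα := hC.alpha_pos
  have hm := hC.m_pos
  have hω0 : 0 ≤ ω := (norm_nonneg _).trans (hw 0 le_rfl)
  have hq0 : 0 ≤ q := by
    rw [hC.q_eq]
    positivity
  set e := Real.exp (-(α₀ / 4 * t)) with he
  have he0 : 0 < e := Real.exp_pos _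
  have he2 : Real.exp (α₀ / 2 * t) * e ^ 2 = 1 := by
    rw [he, sq, ← Real.exp_add, ← Real.exp_add, ← Real.exp_zero]
    congr 1
    ring
  set a := √(‖actCLM P‖ / m) with ha
  set b := √(q / (α₀ / 2) / m) with hb
  have ha0 : 0 ≤ a := Real.sqrt_nonneg _
  have hb0 : 0 ≤ b := Real.sqrt_nonneg _
  have ha2 : m * a ^ 2 = ‖actCLM P‖ := by
    rw [ha, Real.sq_sqrt (by positivity)]; field_simp
  have hb2 : m * b ^ 2 = q / (α₀ / 2) := by
    rw [hb, Real.sq_sqrt (by positivity)]; field_simp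
  have h1 : quadForm P (z t) ≤ quadForm P (z 0) * e ^ 2 + q * (ω + 1) ^ 2 / (α₀ / 2) := by
    have := mul_le_mul_of_nonneg_right h (sq_nonneg e)
    rw [mul_assoc, he2] at this
    linarith
  have h2 : m * ‖z t‖ ^ 2 ≤ m * (a * ‖z 0‖ * e) ^ 2 + m * (b * (ω + 1)) ^ 2 := by
    have h3 := hC.quad (z t)
    have h4 := mul_le_mul_of_nonneg_right (quadForm_le P (z 0)) (sq_nonneg e)
    have h5 : q * (ω + 1) ^ 2 / (α₀ / 2) = m * (b * (ω + 1)) ^ 2 := by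
      rw [mul_pow, ← mul_assoc, hb2]; ring
    have h6 : ‖actCLM P‖ * ‖z 0‖ ^ 2 * e ^ 2 = m * (a * ‖z 0‖ * e) ^ 2 := by
      rw [← ha2]; ring
    linarith
  have h3 : ‖z t‖ ^ 2 ≤ (a * ‖z 0‖ * e) ^ 2 + (b * (ω + 1)) ^ 2 := by
    rw [← mul_add] at h2
    exact le_of_mul_le_mul_left h2 hm
  have h4 : ‖z t‖ ≤ a * ‖z 0‖ * e + b * (ω + 1) := by
    refine abs_le_of_sq_le_sq' ?_ (by positivity) |>.2
    have : 0 ≤ (a * ‖z 0‖ * e) * (b * (ω + 1)) := by positivity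
    nlinarith
  have h5 : 0 ≤ ‖z 0‖ * e := by positivity
  linarith

theorem Constants.isISpS (hC : Constants S G P α₀ μ ω₀ c m q τ σ) (hD : S.D = 0)
    (hp : ∃ ℓ : ℝ≥0, LipschitzWith ℓ S.p) :
    IsISpS ω₀ (IsETTrajectory S G ⟨τ, σ, 1⟩ ⟨τ, σ, 1⟩) := by
  have hα : 0 < α₀ / 4 := by linarith [hC.alpha_pos]
  have hk : 0 < √(‖actCLM P‖ / m) + 1 := by positivity
  have hl : 0 < √(q / (α₀ / 2) / m) + 1 := by positivity
  refine ⟨_, _, Real.toNNReal (√(q / (α₀ / 2) / m) + 1),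
    classKL_exp (Real.toNNReal_pos.2 hk) (Real.toNNReal_pos.2 hα),
    classK_const_mul (Real.toNNReal_pos.2 hl),
    fun w hw => ⟨fun z₀ => exists_isETTrajectory hp _ _ hw.1 hw.2 z₀, fun z hz t => ?_⟩⟩
  rw [← NNReal.coe_le_coe]
  push_cast
  rw [Real.coe_toNNReal _ hk.le, Real.coe_toNNReal _ hl.le, Real.coe_toNNReal _ hα.le,
    Real.coe_toNNReal _ (Real.exp_pos _).le]
  exact hC.norm_le_of_trajectory hD (fun t ht => norm_le_supNorm hw ht) (supNorm_le hw) hz t.2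

end Stability

end ETC

/-! ### Choice of the dwell times and thresholds. -/

theorem theorem4 {nx nu ny nq np nw : ℕ}
    (S : ETC.Plant nx nu ny nq np nw) (G : ETC.Gains nx nu ny nq np)
    (P : Matrix (Fin nx ⊕ Fin nx) (Fin nx ⊕ Fin nx) ℝ) (α₀ μ ω₀ : ℝ)
    (hD : S.D = 0) (hp0 : S.p 0 = 0) (hp : ∃ ℓ : ℝ≥0, LipschitzWith ℓ S.p)
    (hα₀ : 0 < α₀) (hμ : 0 < μ) (hω₀ : 0 < ω₀) (hP : P.PosDef)
    (hV : ETC.DissipationInequality S G P α₀ μ ω₀) :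
    ∃ τy σy εy τu σu εu : ℝ,
      0 < τy ∧ 0 < σy ∧ 0 < εy ∧ 0 < τu ∧ 0 < σu ∧ 0 < εu ∧
      ETC.IsISpS ω₀ (ETC.IsETTrajectory S G ⟨τy, σy, εy⟩ ⟨τu, σu, εu⟩) := by
  obtain ⟨c₀, hc₀⟩ := ETC.exists_loopBounds S G P hD hp0 hp hV
  obtain ⟨m, hm, hquad⟩ := ETC.exists_mul_norm_sq_le_quadForm hP
  obtain ⟨c, hc0, hc2, hcμ, hcC, hcF⟩ : ∃ c : ℝ, c₀ ≤ c ∧ 2 ≤ c ∧ μ ≤ c ∧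
      ‖ETC.actCLM S.C‖ ≤ c ∧ 2 * ‖ETC.actCLM S.Fw‖ ≤ c :=
    ⟨max c₀ (max 2 (max μ (max ‖ETC.actCLM S.C‖ (2 * ‖ETC.actCLM S.Fw‖)))), by simp⟩
  have hcpos : 0 < c := by linarith
  set q : ℝ := 3 * (144 * c ^ 4 / (α₀ * m) + 11 * c ^ 2) with hq
  have hqpos : 0 < q := by positivity
  -- The largest `σ` and, in the next line, the largest `τ` that the constraints of `Constants`
  -- permit; both mechanisms share them.
  have hσpos : 0 < min 1 (α₀ * m / (8 * c ^ 2)) := lt_min one_pos (by positivity)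
  have hτpos : 0 < (q + α₀ / 2)⁻¹ := by positivity
  have hC : ETC.Constants S G P α₀ μ ω₀ c m q (q + α₀ / 2)⁻¹ (min 1 (α₀ * m / (8 * c ^ 2))) :=
    { loop := hc₀.mono hc0
      two_le := hc2
      mu_le := hcμ
      C_le := hcC
      Fw_le := hcF
      alpha_pos := hα₀
      m_pos := hm
      quad := hquad
      sigma_nonneg := hσpos.le
      sigma_le_one := min_le_left _ _
      sigma_le := by
        rw [← le_div_iff₀' (by positivity)]
        exact min_le_right _ _
      q_eq := hq
      tau_pos := hτpos
      tau_le := by rw [inv_inv] }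
  exact ⟨_, _, 1, _, _, 1, hτpos, hσpos, one_pos, hτpos, hσpos, one_pos, hC.isISpS hD hp⟩
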